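/- Let $0<q<1$, and put $(x)_\infty=\prod_{k=0}^\infty(1-xq^k)$ and $\theta(x)=(x)_\infty(q/x)_\infty$ for complex $x\neq 0$; let $\theta'$ be the derivative of $\theta$. For a skew-symmetric complex matrix $A=(a_{ij})_{i,j=1}^{n}$ with $n=2m$ or $n=2m+1$, $m\ge 0$, let $$\operatorname{pfaff}(A)=\frac1{2^m m!}\sum_{\sigma\in S_n}\operatorname{sgn}(\sigma)\prod_{i=1}^m a_{\sigma(2i-1),\sigma(2i)} .$$ Let $m\ge 0$ be an integer. (i) Let $x_1,\dots,x_{2m}$ be non-zero complex numbers such that $\theta(\sqrt q\,x_j/x_i)\neq0$ for all $i\ne j$. Then the matrix below is skew-symmetric, and $$\operatorname*{pfaff}_{1\le i,j\le 2m}\left(\frac{\theta(x_j/x_i)}{x_j\,\theta(\sqrt q\,x_j/x_i)}\right)=q^{\frac14m(m-1)}\prod_{i=1}^{2m}x_i^{m-i}\prod_{1\le i<j\le 2m}\frac{\theta(x_j/x_i)}{\theta(\sqrt q\,x_j/x_i)} .$$ (ii) Let $x_1,\dots,x_{2m+1}$ be non-zero complex numbers such that $\theta(\sqrt q\,x_j/x_i)\neq0$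 for all $i\ne j$. Then the matrix below is skew-symmetric, and $$\operatorname*{pfaff}_{1\le i,j\le 2m+1}\left(\frac{x_i\,\theta'(\sqrt q\,x_i/x_j)}{x_j\,\theta(\sqrt q\,x_i/x_j)}\right)=q^{\frac14m(m-1)}\frac{(q)_\infty^{2m}}{(\sqrt q)_\infty^{2m}}\prod_{i=1}^{2m+1}x_i^{m+1-i}\prod_{1\le i<j\le 2m+1}\frac{\theta(x_j/x_i)}{\theta(\sqrt q\,x_j/x_i)} .$$ -/

import Mathlib

/-- The infinite `q`-shifted factorial `(x; q)_∞ = ∏_{j ≥ 0} (1 - x q^j)`. -/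
noncomputable def qPoch (q x : ℂ) : ℂ := ∏' j : ℕ, (1 - x * q ^ j)

/-- The theta function `θ(x; q) = (x; q)_∞ (q/x; q)_∞`. -/
noncomputable def qTheta (q x : ℂ) : ℂ := qPoch q x * qPoch q (q / x)

/-- The derivative `θ'(x; q)` with respect to the variable `x`. -/
noncomputable def qThetaDeriv (q x : ℂ) : ℂ := deriv (fun z : ℂ => qTheta q z) x

/-- For `|q| < 1` the product defining `(x; q)_∞` converges for every `x`. -/
theorem multipliable_qPoch {q : ℂ} (hq : ‖q‖ < 1) (x : ℂ) :
    Multipliable fun j : ℕ => 1 - x * q ^ j := by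
  have h : Summable fun j : ℕ => ‖-(x * q ^ j)‖ := by
    simpa [norm_mul, norm_pow] using
      (summable_geometric_of_lt_one (norm_nonneg q) hq).mul_left ‖x‖
  simpa [sub_eq_add_neg] using multipliable_one_add_of_summable h

/-- For `|q| < 1` the function `x ↦ (x; q)_∞` is entire. -/
theorem differentiable_qPoch {q : ℂ} (hq : ‖q‖ < 1) :
    Differentiable ℂ fun x : ℂ => qPoch q x := by
  intro x₀
  have hs : Summable fun j : ℕ => (‖x₀‖ + 1) * ‖q‖ ^ j :=
    (summable_geometric_of_lt_one (norm_nonneg q) hq).mul_left _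
  have hm := hs.multipliableLocallyUniformlyOn_nat_one_add
    (f := fun (j : ℕ) (x : ℂ) => -(x * q ^ j)) (K := Metric.ball (0 : ℂ) (‖x₀‖ + 1))
    Metric.isOpen_ball
    (Filter.Eventually.of_forall fun j x hx => by
      rw [norm_neg, norm_mul, norm_pow]
      have : ‖x‖ < ‖x₀‖ + 1 := by simpa using hx
      gcongr)
    (fun j => by fun_prop)
  have hd := hm.hasProdLocallyUniformlyOn.differentiableOn
    (Filter.Eventually.of_forall fun s => by fun_prop) Metric.isOpen_ball
  have hx : x₀ ∈ Metric.ball (0 : ℂ) (‖x₀‖ + 1) := by simp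
  have := hd.differentiableAt (Metric.isOpen_ball.mem_nhds hx)
  simpa [qPoch, sub_eq_add_neg] using this

/-- For `|q| < 1` the theta function is holomorphic on `ℂ ∖ {0}`, so that `θ'` is its genuine
derivative there. -/
theorem differentiableAt_qTheta {q : ℂ} (hq : ‖q‖ < 1) {x : ℂ} (hx : x ≠ 0) :
    DifferentiableAt ℂ (fun z : ℂ => qTheta q z) x :=
  ((differentiable_qPoch hq) x).mul
    (((differentiable_qPoch hq) (q / x)).comp x ((differentiableAt_const q).div differentiableAt_id hx))

/-- The pfaffian of a matrix of size `2m`: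
`1 / (2^m m!) * ∑_σ sgn(σ) ∏_{i=1}^m a_{σ(2i-1), σ(2i)}`; the indices below are shifted by one,
so that the pairs are `(0, 1), (2, 3), …`. -/
noncomputable def pfaffEven (m : ℕ) (A : Matrix (Fin (2 * m)) (Fin (2 * m)) ℂ) : ℂ :=
  1 / (2 ^ m * (Nat.factorial m : ℂ)) *
    ∑ σ : Equiv.Perm (Fin (2 * m)), ((Equiv.Perm.sign σ : ℤ) : ℂ) *
      ∏ i : Fin m, A (σ ⟨2 * (i : ℕ), by omega⟩) (σ ⟨2 * (i : ℕ) + 1, by omega⟩)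

/-- The pfaffian of a matrix of odd size `2m + 1`, given by the same formula with
`σ` running over `S_{2m+1}`. -/
noncomputable def pfaffOdd (m : ℕ) (A : Matrix (Fin (2 * m + 1)) (Fin (2 * m + 1)) ℂ) : ℂ :=
  1 / (2 ^ m * (Nat.factorial m : ℂ)) *
    ∑ σ : Equiv.Perm (Fin (2 * m + 1)), ((Equiv.Perm.sign σ : ℤ) : ℂ) *
      ∏ i : Fin m, A (σ ⟨2 * (i : ℕ), by omega⟩) (σ ⟨2 * (i : ℕ) + 1, by omega⟩)

/-- The matrix with entries `θ(x_j / x_i) / (x_j θ(√q x_j / x_i))`. -/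
noncomputable def thetaMatrixEven (q : ℝ) {n : ℕ} (x : Fin n → ℂ) : Matrix (Fin n) (Fin n) ℂ :=
  Matrix.of fun i j =>
    qTheta (q : ℂ) (x j / x i) /
      (x j * qTheta (q : ℂ) ((Real.sqrt q : ℂ) * x j / x i))

/-- The matrix with entries `x_i θ'(√q x_i / x_j) / (x_j θ(√q x_i / x_j))`. -/
noncomputable def thetaMatrixOdd (q : ℝ) {n : ℕ} (x : Fin n → ℂ) : Matrix (Fin n) (Fin n) ℂ :=
  Matrix.of fun i j =>
    x i * qThetaDeriv (q : ℂ) ((Real.sqrt q : ℂ) * x i / x j) /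
      (x j * qTheta (q : ℂ) ((Real.sqrt q : ℂ) * x i / x j))

/-! ### The theta function -/

/-! Put p = √q and x_i = w_i². The function s(a,b) = a θ(b²/a²) / (b θ(p b²/a²)) (`qSn`) is skew in
its arguments and plays the role of Jacobi's sn. The even matrix has entries s(w_i,w_j)/(w_i w_j),
so up to monomials the claim is pf s(w_i,w_j) = p^(m choose 2) ∏_{i<j} s(w_i,w_j). For four points
this is an addition formula (`qSn_four_term`), obtained from two instances of Weierstrass'
three-term relation (`qTheta_three_term`), which is itself a Liouville argument on the torus.

The four-point case forces the general one. Expanding the Pfaffian along its first row turns the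
induction step into a partial fraction identity for s at 2k+1 points
(`FourTermRelation.sum_eq_prod`). That identity is proved by adjoining two points at a time. The
four-term relation splits each summand into three. One is handled by induction, the other two by the
same identity with s replaced by 1/s; the latter follows from a half-period translation, which sends
s to a constant multiple of 1/s.

The odd matrix has entries ζ(w_i,w_j) (`qZeta`), a logarithmic derivative of θ. Differentiating
Weierstrass' relation gives ζ₁₂ - ζ₁₃ + ζ₂₃ = κ s₁₂ s₁₃ s₂₃ (`qZeta_three_term`). In odd size the
first-row expansion leaves a remainder in which the first index is unpaired. It does not involve the
first point, so it is removed by subtracting the Pfaffian with the first point replaced by the last,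
which is 0. The three-term relation then brings back the partial fraction identity
(`FourTermRelation.pf_eq_of_three_term`).

These arguments divide by values of s, so they need θ(x_j/x_i) ≠ 0 for i ≠ j. Such points are dense,
and continuity gives the remaining cases (`eq_of_generic`). -/

theorem qPoch_eq_one_sub_mul {q : ℂ} (hq : ‖q‖ < 1) (x : ℂ) :
    qPoch q x = (1 - x) * qPoch q (q * x) := by
  have e : ∀ j : ℕ, 1 - q * x * q ^ j = 1 - x * q ^ (j + 1) := fun j => by ring
  have h : Multipliable fun j : ℕ => 1 - x * q ^ (j + 1) :=
    (multipliable_congr e).1 (multipliable_qPoch hq (q * x))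
  have h2 : qPoch q (q * x) = ∏' j : ℕ, (1 - x * q ^ (j + 1)) := tprod_congr e
  have h3 := tprod_eq_zero_mul' (f := fun j : ℕ => 1 - x * q ^ j) h
  rw [h2]
  simpa only [qPoch, pow_zero, mul_one] using h3

theorem qPoch_eq_zero_iff {q : ℂ} (hq : ‖q‖ < 1) (x : ℂ) :
    qPoch q x = 0 ↔ ∃ j : ℕ, x * q ^ j = 1 := by
  constructor
  · intro h
    by_contra! hne
    refine tprod_one_add_ne_zero_of_summable (f := fun j : ℕ => -(x * q ^ j)) ?_ ?_ ?_
    · intro j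
      rw [← sub_eq_add_neg]
      exact sub_ne_zero.2 (hne j).symm
    · simpa [norm_mul, norm_pow] using
        (summable_geometric_of_lt_one (norm_nonneg q) hq).mul_left ‖x‖
    · simpa [qPoch, sub_eq_add_neg] using h
  · rintro ⟨j, hj⟩
    exact tprod_of_exists_eq_zero ⟨j, by rw [hj, sub_self]⟩

theorem qTheta_div {q : ℂ} (hq0 : q ≠ 0) (x : ℂ) : qTheta q (q / x) = qTheta q x := by
  rw [qTheta, qTheta, div_div_cancel₀ hq0, mul_comm]

theorem qTheta_eq_one_sub_mul {q : ℂ} (hq : ‖q‖ < 1) (x : ℂ) :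
    qTheta q x = (1 - x) * (qPoch q (q * x) * qPoch q (q / x)) := by
  rw [qTheta, qPoch_eq_one_sub_mul hq]
  ring

theorem qTheta_inv {q x : ℂ} (hq : ‖q‖ < 1) (hx : x ≠ 0) :
    qTheta q x⁻¹ = -(qTheta q x / x) := by
  rw [qTheta_eq_one_sub_mul hq, qTheta_eq_one_sub_mul hq, div_inv_eq_mul, ← div_eq_mul_inv]
  field_simp
  ring

theorem qTheta_mul_left {q x : ℂ} (hq0 : q ≠ 0) (hq : ‖q‖ < 1) (hx : x ≠ 0) :
    qTheta q (q * x) = -(qTheta q x / x) := by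
  rw [← qTheta_inv hq hx, ← qTheta_div hq0 x⁻¹, div_inv_eq_mul]

theorem qTheta_one {q : ℂ} (hq : ‖q‖ < 1) : qTheta q 1 = 0 := by
  rw [qTheta_eq_one_sub_mul hq]
  simp

theorem qTheta_eq_zero_iff {q x : ℂ} (hq0 : q ≠ 0) (hq : ‖q‖ < 1) (hx : x ≠ 0) :
    qTheta q x = 0 ↔ ∃ k : ℤ, x = q ^ k := by
  rw [qTheta, mul_eq_zero, qPoch_eq_zero_iff hq, qPoch_eq_zero_iff hq]
  constructor
  · rintro (⟨j, hj⟩ | ⟨j, hj⟩)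
    · exact ⟨-j, by rw [zpow_neg, zpow_natCast]; exact eq_inv_of_mul_eq_one_left hj⟩
    · refine ⟨j + 1, ?_⟩
      rw [zpow_add_one₀ hq0, zpow_natCast]
      field_simp at hj
      rw [← hj]
      ring
  · rintro ⟨k, rfl⟩
    obtain ⟨n, rfl | rfl⟩ := k.eq_nat_or_neg
    · rcases n with _ | n
      · exact Or.inl ⟨0, by simp⟩
      · refine Or.inr ⟨n, ?_⟩
        rw [zpow_natCast, div_mul_eq_mul_div, ← pow_succ', div_self (pow_ne_zero _ hq0)]
    · exact Or.inl ⟨n, by rw [zpow_neg, zpow_natCast, inv_mul_cancel₀ (pow_ne_zero _ hq0)]⟩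

theorem hasDerivAt_qTheta {q x : ℂ} (hq : ‖q‖ < 1) (hx : x ≠ 0) :
    HasDerivAt (qTheta q) (qThetaDeriv q x) x :=
  (differentiableAt_qTheta hq hx).hasDerivAt

theorem continuousAt_qTheta {q x : ℂ} (hq : ‖q‖ < 1) (hx : x ≠ 0) :
    ContinuousAt (qTheta q) x :=
  (hasDerivAt_qTheta hq hx).continuousAt

theorem continuousAt_qThetaDeriv {q x : ℂ} (hq : ‖q‖ < 1) (hx : x ≠ 0) :
    ContinuousAt (qThetaDeriv q) x := by
  have hd : DifferentiableOn ℂ (fun z => qTheta q z) {0}ᶜ := fun z hz =>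
    (differentiableAt_qTheta hq hz).differentiableWithinAt
  have hU : IsOpen ({0}ᶜ : Set ℂ) := isOpen_compl_singleton
  exact ((hd.deriv hU).differentiableAt (hU.mem_nhds hx)).continuousAt

theorem qThetaDeriv_one {q : ℂ} (hq : ‖q‖ < 1) : qThetaDeriv q 1 = -qPoch q q ^ 2 := by
  have hg : DifferentiableAt ℂ (fun z : ℂ => qPoch q (q * z) * qPoch q (q / z)) 1 :=
    ((differentiable_qPoch hq _).comp (1 : ℂ) (by fun_prop)).mul
      ((differentiable_qPoch hq _).comp (1 : ℂ)
        ((differentiableAt_const q).div differentiableAt_id one_ne_zero))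
  have h1 : HasDerivAt (fun z : ℂ => 1 - z) (-1) 1 := by
    simpa using (hasDerivAt_id (1 : ℂ)).const_sub 1
  have h := h1.mul hg.hasDerivAt
  have h2 : HasDerivAt (qTheta q) (-qPoch q q ^ 2) 1 := by
    have e1 : qTheta q = (fun z => 1 - z) * fun z => qPoch q (q * z) * qPoch q (q / z) :=
      funext (qTheta_eq_one_sub_mul hq)
    rw [e1]
    refine h.congr_deriv ?_
    simp [pow_two]
  exact (hasDerivAt_qTheta hq one_ne_zero).unique h2

theorem qThetaDeriv_mul_left {q x : ℂ} (hq0 : q ≠ 0) (hq : ‖q‖ < 1) (hx : x ≠ 0) :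
    q * qThetaDeriv q (q * x) = qTheta q x / x ^ 2 - qThetaDeriv q x / x := by
  have h1 : HasDerivAt (fun z => qTheta q (q * z)) (qThetaDeriv q (q * x) * q) x := by
    have h := (hasDerivAt_id x).const_mul q
    rw [mul_one] at h
    exact (hasDerivAt_qTheta hq (mul_ne_zero hq0 hx)).comp x h
  have h2 := ((hasDerivAt_qTheta hq hx).div (hasDerivAt_id x) hx).neg
  have h3 : (fun z => qTheta q (q * z)) =ᶠ[nhds x] -(qTheta q / id) := by
    filter_upwards [isOpen_compl_singleton.mem_nhds hx] with z hz
    exact qTheta_mul_left hq0 hq hz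
  have := (h1.congr_of_eventuallyEq h3.symm).unique h2
  rw [mul_comm, this]
  simp only [id]
  field_simp
  ring

/-- All zeros of θ are simple: the one at 1 has derivative -(q)_∞² ≠ 0, and quasi-periodicity
carries this to every power of q in both directions. -/
theorem qThetaDeriv_zpow_ne_zero {q : ℂ} (hq0 : q ≠ 0) (hq : ‖q‖ < 1) (k : ℤ) :
    qThetaDeriv q (q ^ k) ≠ 0 := by
  have hstep : ∀ k : ℤ, q * qThetaDeriv q (q ^ (k + 1)) = -(qThetaDeriv q (q ^ k) / q ^ k) := by
    intro k
    have hk : q ^ k ≠ 0 := zpow_ne_zero _ hq0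
    rw [zpow_add_one₀ hq0, mul_comm (q ^ k) q, qThetaDeriv_mul_left hq0 hq hk,
      (qTheta_eq_zero_iff hq0 hq hk).2 ⟨k, rfl⟩]
    ring
  induction k using Int.induction_on with
  | zero =>
    rw [zpow_zero, qThetaDeriv_one hq, neg_ne_zero]
    refine pow_ne_zero _ fun h => ?_
    obtain ⟨j, hj⟩ := (qPoch_eq_zero_iff hq q).1 h
    have : ‖q ^ (j + 1)‖ < 1 := by
      rw [norm_pow]
      exact pow_lt_one₀ (norm_nonneg q) hq (Nat.succ_ne_zero j)
    rw [pow_succ', hj] at this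
    simp at this
  | succ n ih =>
    intro h
    have := hstep n
    rw [h, mul_zero, eq_comm, neg_eq_zero, div_eq_zero_iff] at this
    exact this.elim ih (zpow_ne_zero _ hq0)
  | pred n ih =>
    intro h
    have := hstep (-n - 1)
    rw [h, zero_div, neg_zero, sub_add_cancel, mul_eq_zero] at this
    exact this.elim hq0 ih

/-! ### Doubly periodic entire functions and quotients with simple zeros -/

theorem Differentiable.eq_const_of_periodic {h : ℂ → ℂ} (hd : Differentiable ℂ h) {a : ℂ}
    (ha : a.re ≠ 0) (h1 : Function.Periodic h a)
    (h2 : Function.Periodic h (2 * Real.pi * Complex.I)) (z w : ℂ) : h z = h w := by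
  refine hd.apply_eq_apply_of_bounded ?_ z w
  set R : ℝ := |a.re| + 2 * Real.pi
  have hK : IsCompact (h '' Metric.closedBall 0 R) :=
    (isCompact_closedBall 0 R).image hd.continuous
  refine hK.isBounded.subset ?_
  rintro _ ⟨z, rfl⟩
  -- Multiples of a are used first to reduce the real part. The later translation by multiples of
  -- 2πi is purely imaginary and leaves it alone.
  set z1 := z - ⌊z.re / a.re⌋ * a with hz1
  set z2 := z1 - ⌊z1.im / (2 * Real.pi)⌋ * (2 * Real.pi * Complex.I) with hz2
  have e1 : h z2 = h z := by
    rw [hz2, h2.sub_int_mul_eq, hz1, h1.sub_int_mul_eq]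
  refine ⟨z2, ?_, e1⟩
  have hpi : (0 : ℝ) < 2 * Real.pi := by positivity
  have hre : z2.re = Int.fract (z.re / a.re) * a.re := by
    rw [Int.fract, sub_mul, div_mul_cancel₀ _ ha, hz2, hz1]
    simp
  have him : z2.im = Int.fract (z1.im / (2 * Real.pi)) * (2 * Real.pi) := by
    rw [Int.fract, sub_mul, div_mul_cancel₀ _ hpi.ne', hz2]
    simp
  rw [mem_closedBall_zero_iff]
  refine (Complex.norm_le_abs_re_add_abs_im z2).trans ?_
  rw [hre, him, abs_mul, abs_mul, abs_of_nonneg (Int.fract_nonneg (z.re / a.re)),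
    abs_of_nonneg (Int.fract_nonneg (z1.im / (2 * Real.pi))), abs_of_pos hpi]
  have := (Int.fract_lt_one (z.re / a.re)).le
  have := (Int.fract_lt_one (z1.im / (2 * Real.pi))).le
  refine add_le_add (mul_le_of_le_one_left (abs_nonneg _) ?_) (mul_le_of_le_one_left hpi.le ?_) <;>
    assumption

/-- If every zero of `D` is simple and a zero of `F`, then `F / D` extends to an entire function. -/
theorem differentiable_div_of_simple_zeros {F D : ℂ → ℂ} (hF : Differentiable ℂ F)
    (hD : Differentiable ℂ D) (h : ∀ w, D w = 0 → F w = 0 ∧ deriv D w ≠ 0) :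
    Differentiable ℂ fun w => if D w = 0 then deriv F w / deriv D w else F w / D w := by
  intro w₀
  by_cases hw : D w₀ = 0
  · obtain ⟨hF0, hD0⟩ := h w₀ hw
    -- Near a common zero both functions lose the factor w - w₀, and the quotient of the two slopes
    -- is holomorphic there because the zero of D is simple.
    have dF : Differentiable ℂ (dslope F w₀) := by
      rw [← differentiableOn_univ, Complex.differentiableOn_dslope Filter.univ_mem]
      exact hF.differentiableOn
    have dD : Differentiable ℂ (dslope D w₀) := by
      rw [← differentiableOn_univ, Complex.differentiableOn_dslope Filter.univ_mem]
      exact hD.differentiableOn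
    have hne : dslope D w₀ w₀ ≠ 0 := by rwa [dslope_same]
    refine ((dF w₀).div (dD w₀) hne).congr_of_eventuallyEq ?_
    filter_upwards [(dD w₀).continuousAt.eventually_ne hne] with w hw'
    have eF := sub_smul_dslope F w₀ w
    have eD := sub_smul_dslope D w₀ w
    rw [hF0, sub_zero, smul_eq_mul] at eF
    rw [hw, sub_zero, smul_eq_mul] at eD
    by_cases hww : w = w₀
    · subst hww
      simp [hw, dslope_same]
    · have h1 : w - w₀ ≠ 0 := sub_ne_zero.2 hww
      rw [if_neg (by rw [← eD]; exact mul_ne_zero h1 hw'), ← eF, ← eD, mul_div_mul_left _ _ h1]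
      rfl
  · refine ((hF w₀).div (hD w₀) hw).congr_of_eventuallyEq ?_
    filter_upwards [(hD w₀).continuousAt.eventually_ne hw] with w hw'
    rw [if_neg hw']
    rfl

/-- Two entire functions with the same factors of automorphy, one vanishing at the zeros of the
other, which are simple, are proportional. -/
theorem mul_eq_mul_of_quasiperiodic {F D e₁ : ℂ → ℂ} (hF : Differentiable ℂ F)
    (hD : Differentiable ℂ D) (h : ∀ w, D w = 0 → F w = 0 ∧ deriv D w ≠ 0) {a : ℂ}
    (ha : a.re ≠ 0) (he : ∀ w, e₁ w ≠ 0) (hF1 : ∀ w, F (w + a) = e₁ w * F w)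
    (hD1 : ∀ w, D (w + a) = e₁ w * D w)
    (hF2 : ∀ w, F (w + 2 * Real.pi * Complex.I) = F w)
    (hD2 : ∀ w, D (w + 2 * Real.pi * Complex.I) = D w) (z w : ℂ) :
    F z * D w = F w * D z := by
  set H : ℂ → ℂ := fun w => if D w = 0 then deriv F w / deriv D w else F w / D w with hH
  have dH : Differentiable ℂ H := differentiable_div_of_simple_zeros hF hD h
  have hmul : ∀ w, F w = H w * D w := by
    intro w
    by_cases hw : D w = 0
    · simp [hw, (h w hw).1]
    · simp [hH, hw]
  have hD0 : ∀ w, D w = 0 → ∀ᶠ z in nhdsWithin w {w}ᶜ, D z ≠ 0 := by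
    intro w hw
    exact (hD w).hasDerivAt.eventually_ne (h w hw).2
  -- Simple zeros are isolated, so periodicity of the quotient need only be checked where D ≠ 0;
  -- continuity of the extension does the rest.
  have hdense : Dense {w | D w ≠ 0} := by
    intro w
    by_cases hw : D w = 0
    · exact mem_closure_of_frequently_of_tendsto (f := id) (b := nhdsWithin w {w}ᶜ)
        (hD0 w hw).frequently (Filter.tendsto_id'.2 nhdsWithin_le_nhds)
    · exact subset_closure hw
  have key : ∀ (b : ℂ) (e : ℂ → ℂ), (∀ w, e w ≠ 0) → (∀ w, F (w + b) = e w * F w) →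
      (∀ w, D (w + b) = e w * D w) → Function.Periodic H b := by
    intro b e he hFb hDb
    have : (fun w => H (w + b)) = H := by
      refine Continuous.ext_on hdense (by have := dH.continuous; fun_prop) dH.continuous ?_
      intro w hw
      have hw : D w ≠ 0 := hw
      have h1 : D (w + b) ≠ 0 := by
        rw [hDb]
        exact mul_ne_zero (he w) hw
      simp only [hH, hw, h1, if_false]
      rw [hFb, hDb, mul_div_mul_left _ _ (he w)]
    exact fun w => congrFun this w
  have hc := dH.eq_const_of_periodic ha (key a e₁ he hF1 hD1)
    (key _ (fun _ => 1) (by simp) (by simpa using hF2) (by simpa using hD2)) z w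
  rw [hmul z, hmul w, hc]
  ring

/-! ### The three-term relation for the theta function -/

/-- The product `θ(ab) θ(a/b)`. -/
noncomputable def qThetaPair (q a b : ℂ) : ℂ := qTheta q (a * b) * qTheta q (a / b)

theorem qThetaPair_self {q a : ℂ} (hq : ‖q‖ < 1) (ha : a ≠ 0) : qThetaPair q a a = 0 := by
  rw [qThetaPair, div_self ha, qTheta_one hq, mul_zero]

theorem qThetaPair_swap {q a b : ℂ} (hq : ‖q‖ < 1) (ha : a ≠ 0) (hb : b ≠ 0) :
    qThetaPair q b a = -(b / a * qThetaPair q a b) := by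
  rw [qThetaPair, qThetaPair, ← inv_div a b, qTheta_inv hq (div_ne_zero ha hb), mul_comm b a]
  field_simp

theorem qThetaPair_mul_left {q a b : ℂ} (hq0 : q ≠ 0) (hq : ‖q‖ < 1) (ha : a ≠ 0) (hb : b ≠ 0) :
    qThetaPair q (q * a) b = (a ^ 2)⁻¹ * qThetaPair q a b := by
  rw [qThetaPair, qThetaPair, mul_assoc, mul_div_assoc, qTheta_mul_left hq0 hq (mul_ne_zero ha hb),
    qTheta_mul_left hq0 hq (div_ne_zero ha hb)]
  field_simp

theorem qThetaPair_inv {q a b : ℂ} (hq : ‖q‖ < 1) (ha : a ≠ 0) (hb : b ≠ 0) :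
    qThetaPair q a⁻¹ b = (a ^ 2)⁻¹ * qThetaPair q a b := by
  rw [qThetaPair, qThetaPair, show a⁻¹ * b = (a / b)⁻¹ by rw [inv_div]; field_simp,
    show a⁻¹ / b = (a * b)⁻¹ by field_simp, qTheta_inv hq (mul_ne_zero ha hb),
    qTheta_inv hq (div_ne_zero ha hb)]
  field_simp

/-- The difference of the two sides of the three-term relation. -/
noncomputable def qThetaDefect (q y u v x : ℂ) : ℂ :=
  qThetaPair q x y * qThetaPair q u v - qThetaPair q x v * qThetaPair q u y -
    u / y * (qThetaPair q y v * qThetaPair q x u)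

section
variable {q y u v x : ℂ}

theorem qThetaDefect_mul_left (hq0 : q ≠ 0) (hq : ‖q‖ < 1) (hy : y ≠ 0) (hu : u ≠ 0) (hv : v ≠ 0)
    (hx : x ≠ 0) : qThetaDefect q y u v (q * x) = (x ^ 2)⁻¹ * qThetaDefect q y u v x := by
  simp only [qThetaDefect, qThetaPair_mul_left hq0 hq hx hy, qThetaPair_mul_left hq0 hq hx hu,
    qThetaPair_mul_left hq0 hq hx hv]
  ring

theorem qThetaDefect_inv (hq : ‖q‖ < 1) (hy : y ≠ 0) (hu : u ≠ 0) (hv : v ≠ 0)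
    (hx : x ≠ 0) : qThetaDefect q y u v x⁻¹ = (x ^ 2)⁻¹ * qThetaDefect q y u v x := by
  simp only [qThetaDefect, qThetaPair_inv hq hx hy, qThetaPair_inv hq hx hu,
    qThetaPair_inv hq hx hv]
  ring

theorem qThetaDefect_self (hq : ‖q‖ < 1) (hu : u ≠ 0) :
    qThetaDefect q y u v u = 0 := by
  rw [qThetaDefect, qThetaPair_self hq hu]
  ring

theorem qThetaDefect_self' (hq : ‖q‖ < 1) (hy : y ≠ 0) (hu : u ≠ 0) :
    qThetaDefect q y u v y = 0 := by
  rw [qThetaDefect, qThetaPair_self hq hy, qThetaPair_swap hq hy hu]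
  ring

theorem qThetaDefect_zpow_mul (hq0 : q ≠ 0) (hq : ‖q‖ < 1) (hy : y ≠ 0) (hu : u ≠ 0) (hv : v ≠ 0)
    (hx : x ≠ 0) (h : qThetaDefect q y u v x = 0) (k : ℤ) :
    qThetaDefect q y u v (q ^ k * x) = 0 := by
  have hk : ∀ k : ℤ, q ^ k * x ≠ 0 := fun k => mul_ne_zero (zpow_ne_zero _ hq0) hx
  have hstep : ∀ k : ℤ, q ^ (k + 1) * x = q * (q ^ k * x) := fun k => by
    rw [zpow_add_one₀ hq0]
    ring
  induction k using Int.induction_on with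
  | zero => simpa using h
  | succ n ih => rw [hstep, qThetaDefect_mul_left hq0 hq hy hu hv (hk _), ih, mul_zero]
  | pred n ih =>
    have := hstep (-n - 1)
    rw [sub_add_cancel] at this
    rw [this, qThetaDefect_mul_left hq0 hq hy hu hv (hk _)] at ih
    exact (mul_eq_zero.1 ih).resolve_left (inv_ne_zero (pow_ne_zero _ (hk _)))

/-- The zeros in x of θ(xu)θ(x/u) are q^k u and q^k u⁻¹. The defect vanishes at u by inspection, at
u⁻¹ by its behaviour under inversion, and at the q-translates by quasi-periodicity. -/
theorem qThetaDefect_of_pair_eq_zero (hq0 : q ≠ 0) (hq : ‖q‖ < 1) (hy : y ≠ 0) (hu : u ≠ 0)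
    (hv : v ≠ 0) (hx : x ≠ 0) (h : qThetaPair q x u = 0) : qThetaDefect q y u v x = 0 := by
  rw [qThetaPair, mul_eq_zero, qTheta_eq_zero_iff hq0 hq (mul_ne_zero hx hu),
    qTheta_eq_zero_iff hq0 hq (div_ne_zero hx hu)] at h
  rcases h with ⟨k, hk⟩ | ⟨k, hk⟩
  · rw [eq_div_of_mul_eq hu hk, div_eq_mul_inv]
    refine qThetaDefect_zpow_mul hq0 hq hy hu hv (inv_ne_zero hu) ?_ k
    rw [qThetaDefect_inv hq hy hu hv hu, qThetaDefect_self hq hu, mul_zero]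
  · rw [(div_eq_iff hu).1 hk]
    exact qThetaDefect_zpow_mul hq0 hq hy hu hv hu (qThetaDefect_self hq hu) k

theorem differentiable_qThetaPair_exp (hq : ‖q‖ < 1) (hu : u ≠ 0) :
    Differentiable ℂ fun w => qThetaPair q (Complex.exp w) u := by
  intro w
  have hw := Complex.exp_ne_zero w
  have h1 := (differentiableAt_qTheta hq (mul_ne_zero hw hu)).comp w
    (Complex.differentiableAt_exp.mul_const u)
  have h2 := (differentiableAt_qTheta hq (div_ne_zero hw hu)).comp w
    (Complex.differentiableAt_exp.div_const u)
  exact h1.mul h2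

theorem deriv_qThetaPair_exp (hq : ‖q‖ < 1) (hu : u ≠ 0) (w : ℂ) :
    deriv (fun w => qThetaPair q (Complex.exp w) u) w =
      qThetaDeriv q (Complex.exp w * u) * (Complex.exp w * u) * qTheta q (Complex.exp w / u) +
      qTheta q (Complex.exp w * u) * (qThetaDeriv q (Complex.exp w / u) * (Complex.exp w / u)) := by
  have hw := Complex.exp_ne_zero w
  have h1 := (hasDerivAt_qTheta hq (mul_ne_zero hw hu)).comp w
    ((Complex.hasDerivAt_exp w).mul_const u)
  have h2 := (hasDerivAt_qTheta hq (div_ne_zero hw hu)).comp w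
    ((Complex.hasDerivAt_exp w).div_const u)
  exact (h1.mul h2).deriv

/-- The two theta factors can vanish together only if u² is a power of q. Otherwise one term of the
product rule survives, and it is nonzero since zeros of θ are simple. -/
theorem deriv_qThetaPair_exp_ne_zero (hq0 : q ≠ 0) (hq : ‖q‖ < 1) (hu : u ≠ 0)
    (hu2 : qTheta q (u ^ 2) ≠ 0) {w : ℂ} (h : qThetaPair q (Complex.exp w) u = 0) :
    deriv (fun w => qThetaPair q (Complex.exp w) u) w ≠ 0 := by
  have hw := Complex.exp_ne_zero w
  rw [deriv_qThetaPair_exp hq hu]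
  set X := Complex.exp w
  have hnot : ¬ (qTheta q (X * u) = 0 ∧ qTheta q (X / u) = 0) := by
    rintro ⟨h1, h2⟩
    obtain ⟨k, hk⟩ := (qTheta_eq_zero_iff hq0 hq (mul_ne_zero hw hu)).1 h1
    obtain ⟨l, hl⟩ := (qTheta_eq_zero_iff hq0 hq (div_ne_zero hw hu)).1 h2
    refine hu2 ((qTheta_eq_zero_iff hq0 hq (pow_ne_zero 2 hu)).2 ⟨k - l, ?_⟩)
    rw [zpow_sub₀ hq0, ← hk, ← hl]
    field_simp
  rw [qThetaPair, mul_eq_zero] at h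
  rcases h with h | h
  · have h' : qTheta q (X / u) ≠ 0 := fun h' => hnot ⟨h, h'⟩
    obtain ⟨k, hk⟩ := (qTheta_eq_zero_iff hq0 hq (mul_ne_zero hw hu)).1 h
    rw [h, zero_mul, add_zero]
    refine mul_ne_zero (mul_ne_zero ?_ (mul_ne_zero hw hu)) h'
    rw [hk]
    exact qThetaDeriv_zpow_ne_zero hq0 hq k
  · have h' : qTheta q (X * u) ≠ 0 := fun h' => hnot ⟨h', h⟩
    obtain ⟨k, hk⟩ := (qTheta_eq_zero_iff hq0 hq (div_ne_zero hw hu)).1 h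
    rw [h, mul_zero, zero_add]
    refine mul_ne_zero h' (mul_ne_zero ?_ (div_ne_zero hw hu))
    rw [hk]
    exact qThetaDeriv_zpow_ne_zero hq0 hq k

/-- With x = e^w, the defect and θ(xu)θ(x/u) have the same multipliers under translation by log q
and 2πi, so they are proportional. The factor of proportionality is 0, because at x = y the defect
vanishes and the product does not. -/
theorem qThetaDefect_eq_zero_of_generic (hq0 : q ≠ 0) (hq : ‖q‖ < 1) (hy : y ≠ 0) (hu : u ≠ 0)
    (hv : v ≠ 0) (hx : x ≠ 0) (hu2 : qTheta q (u ^ 2) ≠ 0) (hyu : qThetaPair q y u ≠ 0) :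
    qThetaDefect q y u v x = 0 := by
  have hexp : ∀ w, Complex.exp (w + Complex.log q) = q * Complex.exp w := fun w => by
    rw [Complex.exp_add, Complex.exp_log hq0, mul_comm]
  have hF : Differentiable ℂ fun w => qThetaDefect q y u v (Complex.exp w) :=
    (((differentiable_qThetaPair_exp hq hy).mul_const _).sub
      ((differentiable_qThetaPair_exp hq hv).mul_const _)).sub
      (((differentiable_qThetaPair_exp hq hu).const_mul _).const_mul _)
  have key := mul_eq_mul_of_quasiperiodic hF (differentiable_qThetaPair_exp hq hu)
    (fun w hw => ⟨qThetaDefect_of_pair_eq_zero hq0 hq hy hu hv (Complex.exp_ne_zero w) hw,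
      deriv_qThetaPair_exp_ne_zero hq0 hq hu hu2 hw⟩)
    (a := Complex.log q) (e₁ := fun w => (Complex.exp w ^ 2)⁻¹)
    (by
      rw [Complex.log_re]
      exact (Real.log_neg (norm_pos_iff.2 hq0) hq).ne)
    (fun w => inv_ne_zero (pow_ne_zero 2 (Complex.exp_ne_zero w)))
    (fun w => by
      simp only [hexp]
      exact qThetaDefect_mul_left hq0 hq hy hu hv (Complex.exp_ne_zero w))
    (fun w => by
      simp only [hexp]
      exact qThetaPair_mul_left hq0 hq (Complex.exp_ne_zero w) hu)
    (fun w => by simp only [Complex.exp_periodic w])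
    (fun w => by simp only [Complex.exp_periodic w])
    (Complex.log x) (Complex.log y)
  simp only [Complex.exp_log hx, Complex.exp_log hy, qThetaDefect_self' hq hy hu, zero_mul,
    mul_eq_zero] at key
  exact key.resolve_right hyu

theorem countable_qTheta_zeros (hq0 : q ≠ 0) (hq : ‖q‖ < 1) :
    {z : ℂ | z ≠ 0 ∧ qTheta q z = 0}.Countable := by
  refine (Set.countable_range fun k : ℤ => q ^ k).mono ?_
  rintro z ⟨hz, h⟩
  obtain ⟨k, hk⟩ := (qTheta_eq_zero_iff hq0 hq hz).1 h
  exact ⟨k, hk.symm⟩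

theorem continuousAt_qThetaPair {f g : ℂ → ℂ} {a : ℂ} (hq : ‖q‖ < 1) (hf : ContinuousAt f a)
    (hg : ContinuousAt g a) (hf0 : f a ≠ 0) (hg0 : g a ≠ 0) :
    ContinuousAt (fun z => qThetaPair q (f z) (g z)) a := by
  have h1 : ContinuousAt (fun z => qTheta q (f z * g z)) a :=
    ContinuousAt.comp (f := fun z => f z * g z) (continuousAt_qTheta hq (mul_ne_zero hf0 hg0))
      (hf.mul hg)
  have h2 : ContinuousAt (fun z => qTheta q (f z / g z)) a :=
    ContinuousAt.comp (f := fun z => f z / g z) (continuousAt_qTheta hq (div_ne_zero hf0 hg0))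
      (hf.div hg hg0)
  exact h1.mul h2

/-- The three-term relation (Weierstrass) for the theta function. -/
theorem qTheta_three_term (hq0 : q ≠ 0) (hq : ‖q‖ < 1) (hx : x ≠ 0) (hy : y ≠ 0) (hu : u ≠ 0)
    (hv : v ≠ 0) :
    qThetaPair q x y * qThetaPair q u v - qThetaPair q x v * qThetaPair q u y =
      u / y * (qThetaPair q y v * qThetaPair q x u) := by
  set Z := {z : ℂ | z ≠ 0 ∧ qTheta q z = 0} with hZ
  have hc : Z.Countable := countable_qTheta_zeros hq0 hq
  -- The values of u excluded by the generic case. They are countably many, so the relation extends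
  -- to all u ≠ 0 by continuity.
  set B : Set ℂ := {0} ∪ ((fun u => u ^ 2) ⁻¹' Z ∪ ((fun u => y * u) ⁻¹' Z ∪ (fun u => y / u) ⁻¹' Z))
  have hB : B.Countable := by
    refine (Set.countable_singleton 0).union (Set.Countable.union ?_ (Set.Countable.union ?_ ?_))
    · rw [← Set.biUnion_preimage_singleton]
      refine hc.biUnion fun c _ => Set.Finite.countable ?_
      by_cases h : ∃ s : ℂ, s ^ 2 = c
      · obtain ⟨s, rfl⟩ := h
        refine (Set.toFinite {s, -s}).subset fun t ht => ?_
        exact sq_eq_sq_iff_eq_or_eq_neg.1 ht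
      · refine Set.finite_empty.subset fun t ht => h ⟨t, ht⟩
    · exact hc.preimage_of_injOn fun a _ b _ h => mul_left_cancel₀ hy h
    · refine hc.preimage_of_injOn fun a _ b _ h => ?_
      simpa [div_eq_mul_inv, hy] using h
  have hdense : Dense Bᶜ := hB.dense_compl ℝ
  have hgood : ∀ t ∈ Bᶜ, qThetaDefect q y t v x = 0 := by
    intro t ht
    simp only [B, Set.mem_compl_iff, Set.mem_union, Set.mem_singleton_iff, Set.mem_preimage,
      not_or, hZ, Set.mem_ofPred_eq, not_and] at ht
    obtain ⟨h0, h1, h2, h3⟩ := ht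
    exact qThetaDefect_eq_zero_of_generic hq0 hq hy h0 hv hx (h1 (pow_ne_zero 2 h0))
      (mul_ne_zero (h2 (mul_ne_zero hy h0)) (h3 (div_ne_zero hy h0)))
  have hcont : ContinuousAt (fun t => qThetaDefect q y t v x) u := by
    have c1 := continuousAt_qThetaPair hq continuousAt_id (continuousAt_const (y := v)) hu hv
    have c2 := continuousAt_qThetaPair hq continuousAt_id (continuousAt_const (y := y)) hu hy
    have c3 := continuousAt_qThetaPair hq (continuousAt_const (y := x)) continuousAt_id hx hu
    exact ((continuousAt_const.mul c1).sub (continuousAt_const.mul c2)).sub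
      ((continuousAt_id.div_const y).mul (continuousAt_const.mul c3))
  have : (nhdsWithin u Bᶜ).NeBot := mem_closure_iff_nhdsWithin_neBot.1 (hdense u)
  have h0 : qThetaDefect q y u v x = 0 :=
    tendsto_nhds_unique (hcont.tendsto.mono_left nhdsWithin_le_nhds)
      (tendsto_const_nhds.congr' (by
        filter_upwards [self_mem_nhdsWithin] with t ht using (hgood t ht).symm))
  exact sub_eq_zero.1 h0

end

/-! ### The quotient `θ(b² / a²) / θ(p b² / a²)` with `p² = q` -/

theorem qTheta_mul_inv {q p : ℂ} (hp0 : p ≠ 0) (hpq : q = p * p) (z : ℂ) :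
    qTheta q (p * z⁻¹) = qTheta q (p * z) := by
  rw [← qTheta_div (q := q) (by rw [hpq]; exact mul_ne_zero hp0 hp0) (p * z), hpq,
    mul_div_mul_left _ _ hp0, div_eq_mul_inv]

theorem qTheta_div_half {q p z : ℂ} (hp0 : p ≠ 0) (hq : ‖q‖ < 1) (hpq : q = p * p) (hz : z ≠ 0) :
    qTheta q (z / p) = -(z / p * qTheta q (p * z)) := by
  have hq0 : q ≠ 0 := by rw [hpq]; exact mul_ne_zero hp0 hp0
  have h := qTheta_mul_left hq0 hq (div_ne_zero hz hp0)
  rw [show q * (z / p) = p * z by rw [hpq]; field_simp] at h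
  rw [h]
  field_simp

/-- θ is invariant under z ↦ q/z, which fixes p and has derivative -1 there. -/
theorem qThetaDeriv_half {q p : ℂ} (hp0 : p ≠ 0) (hq : ‖q‖ < 1) (hpq : q = p * p) :
    qThetaDeriv q p = 0 := by
  have hq0 : q ≠ 0 := by rw [hpq]; exact mul_ne_zero hp0 hp0
  have h1 := hasDerivAt_qTheta hq hp0
  have h2 : HasDerivAt (fun z => q / z) (-1) p := by
    have := (hasDerivAt_inv hp0).const_mul q
    refine this.congr_deriv ?_
    rw [hpq]
    field_simp
  have hqp : q / p = p := by rw [hpq, mul_div_assoc, div_self hp0, mul_one]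
  have h3 : HasDerivAt (fun z => qTheta q (q / z)) (qThetaDeriv q p * (-1)) p := by
    refine HasDerivAt.comp p (h₂ := qTheta q) ?_ h2
    rw [hqp]
    exact h1
  simp only [qTheta_div hq0] at h3
  have := h1.unique h3
  linear_combination this / 2

theorem qThetaDeriv_inv {q z : ℂ} (hq : ‖q‖ < 1) (hz : z ≠ 0) :
    qThetaDeriv q z⁻¹ = z * qThetaDeriv q z - qTheta q z := by
  have h1 : HasDerivAt (fun z => qTheta q z⁻¹) (qThetaDeriv q z⁻¹ * (-(z ^ 2)⁻¹)) z :=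
    HasDerivAt.comp z (h₂ := qTheta q) (hasDerivAt_qTheta hq (inv_ne_zero hz)) (hasDerivAt_inv hz)
  have h2 := ((hasDerivAt_qTheta hq hz).div (hasDerivAt_id z) hz).neg
  have h3 : (fun z => qTheta q z⁻¹) =ᶠ[nhds z] -(qTheta q / id) := by
    filter_upwards [isOpen_compl_singleton.mem_nhds hz] with w hw
    exact qTheta_inv hq hw
  have h := (h1.congr_of_eventuallyEq h3.symm).unique h2
  simp only [id] at h
  field_simp at h
  rw [one_div] at h
  linear_combination -h

/-- The odd function `a θ(b² / a²) / (b θ(p b² / a²))` of `b / a`. -/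
noncomputable def qSn (q p a b : ℂ) : ℂ :=
  a / b * (qTheta q (b ^ 2 / a ^ 2) / qTheta q (p * (b ^ 2 / a ^ 2)))

/-- The function `(a² / b²) θ'(p a² / b²) / θ(p a² / b²)` of `a / b`. -/
noncomputable def qZeta (q p a b : ℂ) : ℂ :=
  a ^ 2 / b ^ 2 * (qThetaDeriv q (p * (a ^ 2 / b ^ 2)) / qTheta q (p * (a ^ 2 / b ^ 2)))

section
variable {q p a b c d : ℂ}

theorem qSn_swap (hp0 : p ≠ 0) (hq : ‖q‖ < 1) (hpq : q = p * p) (ha : a ≠ 0) (hb : b ≠ 0) :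
    qSn q p b a = -qSn q p a b := by
  have h1 := qTheta_inv hq (div_ne_zero (pow_ne_zero 2 hb) (pow_ne_zero 2 ha))
  have h2 := qTheta_mul_inv hp0 hpq (b ^ 2 / a ^ 2)
  rw [inv_div] at h1 h2
  rw [qSn, qSn, h1, h2]
  field_simp

theorem qTheta_half_ne_zero_of_qSn (h : qSn q p a b ≠ 0) : qTheta q (p * (b ^ 2 / a ^ 2)) ≠ 0 := by
  intro h0
  rw [qSn, h0, div_zero, mul_zero] at h
  exact h rfl

/-- Replacing a by ra divides b²/a² by p, which interchanges numerator and denominator because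
θ(z/p) is a monomial times θ(pz). -/
theorem qSn_shift {r : ℂ} (hp0 : p ≠ 0) (hq : ‖q‖ < 1) (hpq : q = p * p) (hr : r * r = p)
    (ha : a ≠ 0) (hb : b ≠ 0) (h : qSn q p a b ≠ 0) :
    qSn q p (r * a) b * qSn q p a b = -r⁻¹ := by
  have hr0 : r ≠ 0 := by
    rintro rfl
    exact hp0 (by simpa using hr.symm)
  have hY := qTheta_half_ne_zero_of_qSn h
  have hX : qTheta q (b ^ 2 / a ^ 2) ≠ 0 := by
    intro h0
    rw [qSn, h0, zero_div, mul_zero] at h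
    exact h rfl
  have e : b ^ 2 / (r * a) ^ 2 = b ^ 2 / a ^ 2 / p := by
    rw [← hr]
    field_simp
  have e2 : p * (b ^ 2 / a ^ 2 / p) = b ^ 2 / a ^ 2 := by field_simp
  rw [qSn, qSn, e, e2, qTheta_div_half hp0 hq hpq (div_ne_zero (pow_ne_zero 2 hb)
    (pow_ne_zero 2 ha))]
  set X := qTheta q (b ^ 2 / a ^ 2)
  set Y := qTheta q (p * (b ^ 2 / a ^ 2))
  rw [← hr]
  field_simp

theorem qSn_eq (hp0 : p ≠ 0) (hq : ‖q‖ < 1) (hpq : q = p * p) (ha : a ≠ 0) (hb : b ≠ 0) :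
    qSn q p a b = -(b / a * (qTheta q (a ^ 2 / b ^ 2) / qTheta q (p * (a ^ 2 / b ^ 2)))) := by
  rw [← neg_eq_iff_eq_neg, ← qSn_swap hp0 hq hpq ha hb, qSn]

theorem qTheta_half_ne_zero_of_qSn' (hp0 : p ≠ 0) (hpq : q = p * p)
    (h : qSn q p a b ≠ 0) : qTheta q (p * (a ^ 2 / b ^ 2)) ≠ 0 := by
  have := qTheta_half_ne_zero_of_qSn h
  rwa [← inv_div, qTheta_mul_inv hp0 hpq] at this

theorem qSn_four_term (hp0 : p ≠ 0) (hq : ‖q‖ < 1) (hpq : q = p * p) (ha : a ≠ 0) (hb : b ≠ 0)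
    (hc : c ≠ 0) (hd : d ≠ 0) (hab : qSn q p a b ≠ 0) (hac : qSn q p a c ≠ 0)
    (had : qSn q p a d ≠ 0) (hbc : qSn q p b c ≠ 0) (hbd : qSn q p b d ≠ 0)
    (hcd : qSn q p c d ≠ 0) :
    qSn q p a b * qSn q p c d - qSn q p a c * qSn q p b d + qSn q p a d * qSn q p b c =
      p * (qSn q p a b * qSn q p a c * qSn q p a d * qSn q p b c * qSn q p b d * qSn q p c d) := by
  have hq0 : q ≠ 0 := by rw [hpq]; exact mul_ne_zero hp0 hp0
  -- Write X for θ of a ratio of squares and Y for θ of p times it. Up to monomials, the first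
  -- instance combines Xab Xcd Yac Ybd and Xac Xbd Yab Ycd into B P Xad Xbc, where P = θ(p) and B =
  -- θ(p (ad/bc)²). The second combines B P Yad Ybc with Yab Ycd Yac Ybd into Xab Xcd Xac Xbd.
  -- Eliminating B P gives the claim.
  have E1 := qTheta_three_term (x := a * c / (b * d)) (y := a * d / (b * c)) (u := a * b / (c * d))
    (v := p * (a * d / (b * c))) hq0 hq (by positivity) (by positivity) (by positivity)
    (by positivity)
  have E2 := qTheta_three_term (x := p * (a * b / (c * d))) (y := a * c / (b * d))
    (u := p * (a * d / (b * c))) (v := a * d / (b * c)) hq0 hq (by positivity) (by positivity)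
    (by positivity) (by positivity)
  have yab := qTheta_half_ne_zero_of_qSn' hp0 hpq hab
  have yac := qTheta_half_ne_zero_of_qSn' hp0 hpq hac
  have yad := qTheta_half_ne_zero_of_qSn' hp0 hpq had
  have ybc := qTheta_half_ne_zero_of_qSn' hp0 hpq hbc
  have ybd := qTheta_half_ne_zero_of_qSn' hp0 hpq hbd
  have ycd := qTheta_half_ne_zero_of_qSn' hp0 hpq hcd
  have t1 : qTheta q (b ^ 2 / d ^ 2 / p) = _ := qTheta_div_half hp0 hq hpq (by positivity)
  have t2 : qTheta q (c ^ 2 / d ^ 2 / p) = _ := qTheta_div_half hp0 hq hpq (by positivity)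
  have t3 : qTheta q (1 / p) = _ := qTheta_div_half hp0 hq hpq one_ne_zero
  have t4 := qTheta_inv (x := b ^ 2 / c ^ 2) hq (by positivity)
  have t5 := qTheta_mul_left (x := a ^ 2 / c ^ 2) hq0 hq (by positivity)
  have t6 := qTheta_mul_inv hp0 hpq (c ^ 2 / d ^ 2)
  rw [inv_div] at t4 t6
  simp only [qThetaPair] at E1 E2
  rw [show a * c / (b * d) * (a * d / (b * c)) = a ^ 2 / b ^ 2 by field_simp,
    show a * c / (b * d) / (a * d / (b * c)) = c ^ 2 / d ^ 2 by field_simp,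
    show a * b / (c * d) * (p * (a * d / (b * c))) = p * (a ^ 2 / c ^ 2) by field_simp,
    show a * b / (c * d) / (p * (a * d / (b * c))) = b ^ 2 / d ^ 2 / p by field_simp,
    show a * c / (b * d) * (p * (a * d / (b * c))) = p * (a ^ 2 / b ^ 2) by field_simp,
    show a * c / (b * d) / (p * (a * d / (b * c))) = c ^ 2 / d ^ 2 / p by field_simp,
    show a * b / (c * d) * (a * d / (b * c)) = a ^ 2 / c ^ 2 by field_simp,
    show a * b / (c * d) / (a * d / (b * c)) = b ^ 2 / d ^ 2 by field_simp,
    show a * d / (b * c) / (p * (a * d / (b * c))) = 1 / p by field_simp,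
    show a * c / (b * d) * (a * b / (c * d)) = a ^ 2 / d ^ 2 by field_simp,
    show a * c / (b * d) / (a * b / (c * d)) = c ^ 2 / b ^ 2 by field_simp,
    t1, t2, t3, t4, mul_one] at E1
  rw [show p * (a * b / (c * d)) * (a * c / (b * d)) = p * (a ^ 2 / d ^ 2) by field_simp,
    show p * (a * b / (c * d)) / (a * c / (b * d)) = p * (b ^ 2 / c ^ 2) by field_simp,
    show p * (a * d / (b * c)) * (a * d / (b * c)) = a * d / (b * c) * (p * (a * d / (b * c))) by
      ring,
    show p * (a * d / (b * c)) / (a * d / (b * c)) = p by field_simp,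
    show p * (a * b / (c * d)) * (a * d / (b * c)) = p * (a ^ 2 / c ^ 2) by field_simp,
    show p * (a * b / (c * d)) / (a * d / (b * c)) = p * (b ^ 2 / d ^ 2) by field_simp,
    show p * (a * d / (b * c)) * (a * c / (b * d)) = p * (a ^ 2 / b ^ 2) by field_simp,
    show p * (a * d / (b * c)) / (a * c / (b * d)) = p * (d ^ 2 / c ^ 2) by field_simp,
    show a * c / (b * d) * (a * d / (b * c)) = a ^ 2 / b ^ 2 by field_simp,
    show a * c / (b * d) / (a * d / (b * c)) = c ^ 2 / d ^ 2 by field_simp,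
    show p * (a * b / (c * d)) * (p * (a * d / (b * c))) = q * (a ^ 2 / c ^ 2) by
      rw [hpq]; field_simp,
    show p * (a * b / (c * d)) / (p * (a * d / (b * c))) = b ^ 2 / d ^ 2 by field_simp,
    t5, t6] at E2
  rw [qSn_eq hp0 hq hpq ha hb, qSn_eq hp0 hq hpq ha hc, qSn_eq hp0 hq hpq ha hd,
    qSn_eq hp0 hq hpq hb hc, qSn_eq hp0 hq hpq hb hd, qSn_eq hp0 hq hpq hc hd]
  generalize qTheta q (a * d / (b * c) * (p * (a * d / (b * c)))) = B at *
  generalize qTheta q p = P at *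
  generalize qTheta q (p * (a ^ 2 / b ^ 2)) = Yab at *
  generalize qTheta q (p * (a ^ 2 / c ^ 2)) = Yac at *
  generalize qTheta q (p * (a ^ 2 / d ^ 2)) = Yad at *
  generalize qTheta q (p * (b ^ 2 / c ^ 2)) = Ybc at *
  generalize qTheta q (p * (b ^ 2 / d ^ 2)) = Ybd at *
  generalize qTheta q (p * (c ^ 2 / d ^ 2)) = Ycd at *
  generalize qTheta q (a ^ 2 / b ^ 2) = Xab at *
  generalize qTheta q (a ^ 2 / c ^ 2) = Xac at *
  generalize qTheta q (a ^ 2 / d ^ 2) = Xad at *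
  generalize qTheta q (b ^ 2 / c ^ 2) = Xbc at *
  generalize qTheta q (b ^ 2 / d ^ 2) = Xbd at *
  generalize qTheta q (c ^ 2 / d ^ 2) = Xcd at *
  clear t1 t2 t3 t4 t5 t6 hab hac had hbc hbd hcd
  rw [← sub_eq_zero] at E1 E2 ⊢
  rw [← mul_zero (-(p * d ^ 3 / (a * b * c)) / (Yab * Yac * Ybd * Ycd)), ← E1]
  rw [← sub_eq_zero, ← mul_zero (-(d * c / (a * b)) * Xad * Xbc / (Yab * Yac * Yad * Ybc * Ybd * Ycd)),
    ← E2]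
  field_simp
  ring

/-- Weierstrass' relation differentiated in u at u = v, where θ(u/v) vanishes and contributes only
through θ'(1). -/
theorem qTheta_three_term_deriv {x y v : ℂ} (hq0 : q ≠ 0) (hq : ‖q‖ < 1) (hx : x ≠ 0) (hy : y ≠ 0)
    (hv : v ≠ 0) :
    qThetaPair q x y * (qTheta q (v * v) * (qThetaDeriv q 1 / v)) -
      qThetaPair q x v * (qThetaDeriv q (v * y) * y * qTheta q (v / y) +
        qTheta q (v * y) * (qThetaDeriv q (v / y) / y)) =
      1 / y * (qThetaPair q y v * qThetaPair q x v) + v / y * (qThetaPair q y v *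
        (qThetaDeriv q (x * v) * x * qTheta q (x / v) -
          qTheta q (x * v) * (qThetaDeriv q (x / v) * (x / v ^ 2)))) := by
  have d1 : ∀ b : ℂ, b ≠ 0 → HasDerivAt (fun u => qThetaPair q u b)
      (qThetaDeriv q (v * b) * b * qTheta q (v / b) +
        qTheta q (v * b) * (qThetaDeriv q (v / b) / b)) v := by
    intro b hb
    have h1 : HasDerivAt (fun u => qTheta q (u * b)) (qThetaDeriv q (v * b) * b) v :=
      HasDerivAt.comp v (h₂ := qTheta q) (hasDerivAt_qTheta hq (mul_ne_zero hv hb))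
        (by simpa using (hasDerivAt_id v).mul_const b)
    have h2 : HasDerivAt (fun u => qTheta q (u / b)) (qThetaDeriv q (v / b) * (1 / b)) v :=
      HasDerivAt.comp v (h₂ := qTheta q) (hasDerivAt_qTheta hq (div_ne_zero hv hb))
        (by simpa using (hasDerivAt_id v).div_const b)
    refine (h1.mul h2).congr_deriv ?_
    ring
  have d2 : HasDerivAt (fun u => qThetaPair q x u)
      (qThetaDeriv q (x * v) * x * qTheta q (x / v) -
          qTheta q (x * v) * (qThetaDeriv q (x / v) * (x / v ^ 2))) v := by
    have h1 : HasDerivAt (fun u => qTheta q (x * u)) (qThetaDeriv q (x * v) * x) v :=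
      HasDerivAt.comp v (h₂ := qTheta q) (hasDerivAt_qTheta hq (mul_ne_zero hx hv))
        (by simpa using (hasDerivAt_id v).const_mul x)
    have h2 : HasDerivAt (fun u => qTheta q (x / u)) (qThetaDeriv q (x / v) * (-(x / v ^ 2))) v :=
      HasDerivAt.comp v (h₂ := qTheta q) (hasDerivAt_qTheta hq (div_ne_zero hx hv))
        (((hasDerivAt_inv hv).const_mul x).congr_deriv (by ring))
    refine (h1.mul h2).congr_deriv ?_
    ring
  have hL := ((d1 v hv).const_mul (qThetaPair q x y)).sub ((d1 y hy).const_mul (qThetaPair q x v))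
  have hR := ((hasDerivAt_id v).div_const y).mul (d2.const_mul (qThetaPair q y v))
  have he : (fun u => qThetaPair q x y * qThetaPair q u v) -
      (fun u => qThetaPair q x v * qThetaPair q u y) =ᶠ[nhds v]
      (fun u => id u / y) * fun u => qThetaPair q y v * qThetaPair q x u := by
    filter_upwards [isOpen_compl_singleton.mem_nhds hv] with u hu
    exact qTheta_three_term hq0 hq hx hy hu hv
  have := hL.unique (hR.congr_of_eventuallyEq he)
  rw [div_self hv, qTheta_one hq] at this
  simp only [id] at this
  rw [← this]
  ring

theorem qZeta_three_term (hp0 : p ≠ 0) (hq : ‖q‖ < 1) (hpq : q = p * p) (ha : a ≠ 0) (hb : b ≠ 0)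
    (hc : c ≠ 0) (hab : qSn q p a b ≠ 0) (hac : qSn q p a c ≠ 0) (hbc : qSn q p b c ≠ 0)
    (hp : qTheta q p ≠ 0) :
    qZeta q p a b - qZeta q p a c + qZeta q p b c =
      qPoch q q ^ 2 / qTheta q p * (qSn q p a b * qSn q p a c * qSn q p b c) := by
  have hq0 : q ≠ 0 := by rw [hpq]; exact mul_ne_zero hp0 hp0
  -- The choice v/y = p makes one derivative term drop out, as θ'(p) = 0; the factor (q)_∞² comes
  -- from θ'(1).
  have E := qTheta_three_term_deriv (x := a * c / b ^ 2) (y := a / c) (v := p * (a / c)) hq0 hq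
    (by positivity) (by positivity) (by positivity)
  have yab := qTheta_half_ne_zero_of_qSn' hp0 hpq hab
  have yac := qTheta_half_ne_zero_of_qSn' hp0 hpq hac
  have ybc := qTheta_half_ne_zero_of_qSn' hp0 hpq hbc
  have t1 := qTheta_inv (x := b ^ 2 / c ^ 2) hq (by positivity)
  have t2 := qTheta_mul_left (x := a ^ 2 / c ^ 2) hq0 hq (by positivity)
  have t3 : qTheta q (1 / p) = _ := qTheta_div_half hp0 hq hpq one_ne_zero
  have t4 := qTheta_inv (x := p * (b ^ 2 / c ^ 2)) hq (by positivity)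
  have t5 := qThetaDeriv_inv (z := p * (b ^ 2 / c ^ 2)) hq (by positivity)
  rw [inv_div] at t1
  simp only [qThetaPair] at E
  rw [show a * c / b ^ 2 * (a / c) = a ^ 2 / b ^ 2 by field_simp,
    show a * c / b ^ 2 / (a / c) = c ^ 2 / b ^ 2 by field_simp,
    show p * (a / c) * (p * (a / c)) = q * (a ^ 2 / c ^ 2) by rw [hpq]; field_simp,
    show a * c / b ^ 2 * (p * (a / c)) = p * (a ^ 2 / b ^ 2) by field_simp,
    show a * c / b ^ 2 / (p * (a / c)) = (p * (b ^ 2 / c ^ 2))⁻¹ by field_simp,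
    show p * (a / c) * (a / c) = p * (a ^ 2 / c ^ 2) by field_simp,
    show p * (a / c) / (a / c) = p by field_simp,
    show a / c * (p * (a / c)) = p * (a ^ 2 / c ^ 2) by field_simp,
    show a / c / (p * (a / c)) = 1 / p by field_simp,
    t1, t2, t3, t4, t5, qThetaDeriv_half hp0 hq hpq, qThetaDeriv_one hq, mul_one] at E
  rw [qSn_eq hp0 hq hpq ha hb, qSn_eq hp0 hq hpq ha hc, qSn_eq hp0 hq hpq hb hc]
  simp only [qZeta]
  clear hab hac hbc t1 t2 t3 t4 t5
  generalize qTheta q p = P at *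
  generalize qPoch q q = Q at *
  generalize qTheta q (p * (a ^ 2 / b ^ 2)) = Yab at *
  generalize qTheta q (p * (a ^ 2 / c ^ 2)) = Yac at *
  generalize qTheta q (p * (b ^ 2 / c ^ 2)) = Ybc at *
  generalize qThetaDeriv q (p * (a ^ 2 / b ^ 2)) = Zab at *
  generalize qThetaDeriv q (p * (a ^ 2 / c ^ 2)) = Zac at *
  generalize qThetaDeriv q (p * (b ^ 2 / c ^ 2)) = Zbc at *
  generalize qTheta q (a ^ 2 / b ^ 2) = Xab at *
  generalize qTheta q (a ^ 2 / c ^ 2) = Xac at *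
  generalize qTheta q (b ^ 2 / c ^ 2) = Xbc at *
  rw [← sub_eq_zero] at E ⊢
  rw [← mul_zero (-(p * a * b ^ 2 / c ^ 3) / (P * Yab * Yac * Ybc)), ← E]
  field_simp
  ring

end

/-! ### A partial fraction identity from a four-term relation -/

section
variable {K X ι : Type*} [Field K] [DecidableEq ι] {f : X → X → K} {τ : X → X} {c e : K}

/-- The four-term relation is the case of four points of the Pfaffian evaluation, and `τ` is a
half-period translation. -/
structure FourTermRelation (f : X → X → K) (τ : X → X) (c e : K) : Prop where
  swap : ∀ a b, f b a = -f a b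
  four_term : ∀ a b c' d, f a b ≠ 0 → f a c' ≠ 0 → f a d ≠ 0 → f b c' ≠ 0 → f b d ≠ 0 → f c' d ≠ 0 →
    f a b * f c' d - f a c' * f b d + f a d * f b c' =
      c * (f a b * f a c' * f a d * f b c' * f b d * f c' d)
  shift : ∀ a b, f a b ≠ 0 → f (τ a) b * f a b = e
  mul_eq_one : c * (e * e) = 1

/-- Evaluate the hypothesis at τ z: every f(τ z, u_j) becomes e / f(z, u_j), and c^k e^(2k+1) = e
since c e² = 1. -/
theorem FourTermRelation.sum_inv_of_sum (hf : FourTermRelation f τ c e) {u : ι → X} {I : Finset ι}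
    {k : ℕ} (hI : I.card = 2 * k + 1)
    (h : ∀ z, (∀ i ∈ I, f z (u i) ≠ 0) →
      ∑ b ∈ I, f z (u b) * ∏ j ∈ I.erase b, (f (u b) (u j))⁻¹ = c ^ k * ∏ j ∈ I, f z (u j))
    {z : X} (hz : ∀ i ∈ I, f z (u i) ≠ 0) :
    ∑ b ∈ I, (f z (u b))⁻¹ * ∏ j ∈ I.erase b, (f (u b) (u j))⁻¹ = ∏ j ∈ I, (f z (u j))⁻¹ := by
  have he : e ≠ 0 := by
    rintro rfl
    simpa using hf.mul_eq_one
  have hτ : ∀ i ∈ I, f (τ z) (u i) = e * (f z (u i))⁻¹ := fun i hi => by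
    rw [← hf.shift _ _ (hz i hi), mul_inv_cancel_right₀ (hz i hi)]
  have h1 := h (τ z) fun i hi => by
    rw [hτ i hi]
    exact mul_ne_zero he (inv_ne_zero (hz i hi))
  rw [Finset.prod_congr rfl hτ, Finset.prod_mul_distrib, Finset.prod_const, hI,
    Finset.sum_congr rfl fun b hb => by rw [hτ b hb, mul_assoc], ← Finset.mul_sum] at h1
  refine mul_left_cancel₀ he (h1.trans ?_)
  rw [← mul_assoc, pow_succ, pow_mul, pow_two, ← mul_assoc, ← mul_pow, hf.mul_eq_one, one_pow,
    one_mul]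

/-- Partial fractions for f, by induction on the number of points in steps of two; the reciprocal
form at the smaller size is needed in the step. -/
theorem FourTermRelation.sum_eq_prod (hf : FourTermRelation f τ c e) {u : ι → X} (k : ℕ) :
    ∀ {I : Finset ι}, I.card = 2 * k + 1 → (∀ i ∈ I, ∀ j ∈ I, i ≠ j → f (u i) (u j) ≠ 0) →
      ∀ z, (∀ i ∈ I, f z (u i) ≠ 0) →
      ∑ b ∈ I, f z (u b) * ∏ j ∈ I.erase b, (f (u b) (u j))⁻¹ = c ^ k * ∏ j ∈ I, f z (u j) := by
  induction k with
  | zero =>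
    intro I hI _ z _
    obtain ⟨a, rfl⟩ := Finset.card_eq_one.1 hI
    simp
  | succ k ih =>
    intro I hI hne z hz
    obtain ⟨v, I', hv, rfl, hI'⟩ := Finset.card_eq_succ.1 (show I.card = (2 * k + 2) + 1 from hI)
    obtain ⟨w, J, hw, rfl, hJ⟩ := Finset.card_eq_succ.1 (show I'.card = (2 * k + 1) + 1 from hI')
    have hvw : v ≠ w := fun h => hv (h ▸ Finset.mem_insert_self _ _)
    have hvJ : v ∉ J := fun h => hv (Finset.mem_insert_of_mem h)
    have mJ : ∀ {j}, j ∈ J → j ∈ insert v (insert w J) := fun h =>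
      Finset.mem_insert_of_mem (Finset.mem_insert_of_mem h)
    have mv : v ∈ insert v (insert w J) := Finset.mem_insert_self _ _
    have mw : w ∈ insert v (insert w J) := Finset.mem_insert_of_mem (Finset.mem_insert_self _ _)
    have ne_v : ∀ {j}, j ∈ J → v ≠ j := fun h h' => hvJ (h' ▸ h)
    have ne_w : ∀ {j}, j ∈ J → w ≠ j := fun h h' => hw (h' ▸ h)
    have ih' := ih hJ fun i hi j hj => hne i (mJ hi) j (mJ hj)
    have hsz := ih' z fun i hi => hz i (mJ hi)
    have hsv := hf.sum_inv_of_sum hJ ih' (z := u v) fun i hi => hne v mv i (mJ hi) (ne_v hi)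
    have hsw := hf.sum_inv_of_sum hJ ih' (z := u w) fun i hi => hne w mw i (mJ hi) (ne_w hi)
    have hfvw := hne v mv w mw hvw
    -- This is the four-term relation at z, u_b, u_v, u_w divided by the three factors not involving
    -- z. Summed over b, the first piece is the induction hypothesis at z; the other two are the
    -- reciprocal identity at u_v and u_w and cancel the summands b = v and b = w.
    have hterm : ∀ b ∈ J, f z (u b) * ∏ j ∈ (insert v (insert w J)).erase b, (f (u b) (u j))⁻¹ =
        c * f z (u v) * f z (u w) * (f z (u b) * ∏ j ∈ J.erase b, (f (u b) (u j))⁻¹) -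
        f z (u v) / f (u v) (u w) * ((f (u v) (u b))⁻¹ * ∏ j ∈ J.erase b, (f (u b) (u j))⁻¹) +
        f z (u w) / f (u v) (u w) *
          ((f (u w) (u b))⁻¹ * ∏ j ∈ J.erase b, (f (u b) (u j))⁻¹) := by
      intro b hb
      have hbv := hne b (mJ hb) v mv (ne_v hb).symm
      have hbw := hne b (mJ hb) w mw (ne_w hb).symm
      have h4 := hf.four_term z (u b) (u v) (u w) (hz b (mJ hb)) (hz v mv) (hz w mw) hbv hbw hfvw
      rw [Finset.erase_insert_of_ne (ne_v hb), Finset.erase_insert_of_ne (ne_w hb),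
        Finset.prod_insert (by simp [hvw, hvJ]), Finset.prod_insert (by simp [hw]),
        hf.swap (u b) (u v), hf.swap (u b) (u w)]
      generalize ∏ j ∈ J.erase b, (f (u b) (u j))⁻¹ = P
      rw [← sub_eq_zero] at h4 ⊢
      rw [← mul_zero (P / (f (u b) (u v) * f (u b) (u w) * f (u v) (u w))), ← h4]
      field_simp
      ring
    rw [Finset.sum_insert hv, Finset.sum_insert hw, Finset.sum_congr rfl hterm,
      Finset.sum_add_distrib, Finset.sum_sub_distrib, ← Finset.mul_sum, ← Finset.mul_sum,
      ← Finset.mul_sum, hsz, hsv, hsw, Finset.erase_insert hv,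
      Finset.erase_insert_of_ne hvw, Finset.erase_insert hw, Finset.prod_insert hw,
      Finset.prod_insert hvJ, Finset.prod_insert hv, Finset.prod_insert hw, hf.swap (u v) (u w)]
    generalize ∏ j ∈ J, (f (u v) (u j))⁻¹ = P
    generalize ∏ j ∈ J, (f (u w) (u j))⁻¹ = P'
    rw [inv_neg]
    ring

/-- The reciprocal identity for 2k+1 of the points, evaluated at the remaining one. -/
theorem FourTermRelation.sum_prod_inv_eq_zero (hf : FourTermRelation f τ c e) {u : ι → X} {k : ℕ}
    {I : Finset ι} (hI : I.card = 2 * k + 2)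
    (hne : ∀ i ∈ I, ∀ j ∈ I, i ≠ j → f (u i) (u j) ≠ 0) :
    ∑ b ∈ I, ∏ j ∈ I.erase b, (f (u b) (u j))⁻¹ = 0 := by
  obtain ⟨v, J, hv, rfl, hJ⟩ := Finset.card_eq_succ.1 (show I.card = (2 * k + 1) + 1 from hI)
  have mv : v ∈ insert v J := Finset.mem_insert_self _ _
  have mJ : ∀ {j}, j ∈ J → j ∈ insert v J := fun h => Finset.mem_insert_of_mem h
  have ne_v : ∀ {j}, j ∈ J → v ≠ j := fun h h' => hv (h' ▸ h)
  have hs := hf.sum_inv_of_sum hJ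
    (hf.sum_eq_prod k hJ fun i hi j hj => hne i (mJ hi) j (mJ hj)) (z := u v)
    fun i hi => hne v mv i (mJ hi) (ne_v hi)
  have hterm : ∀ b ∈ J, ∏ j ∈ (insert v J).erase b, (f (u b) (u j))⁻¹ =
      -((f (u v) (u b))⁻¹ * ∏ j ∈ J.erase b, (f (u b) (u j))⁻¹) := by
    intro b hb
    rw [Finset.erase_insert_of_ne (ne_v hb), Finset.prod_insert (by simp [hv]),
      hf.swap (u v) (u b), inv_neg, neg_mul]
  rw [Finset.sum_insert hv, Finset.erase_insert hv, Finset.sum_congr rfl hterm,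
    Finset.sum_neg_distrib, hs, add_neg_cancel]

end

/-! ### Pfaffian sums -/

section
variable {K : Type*} [Field K] {m n : ℕ}

/-- The position `2i` of a list of `n ≥ 2m` positions. -/
def pairFst (h : 2 * m ≤ n) (i : Fin m) : Fin n := ⟨2 * (i : ℕ), by omega⟩

/-- The position `2i + 1` of a list of `n ≥ 2m` positions. -/
def pairSnd (h : 2 * m ≤ n) (i : Fin m) : Fin n := ⟨2 * (i : ℕ) + 1, by omega⟩

/-- The term of a permutation in the Pfaffian sum. -/
def pfTerm (h : 2 * m ≤ n) (A : Fin n → Fin n → K) (σ : Equiv.Perm (Fin n)) : K :=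
  ((Equiv.Perm.sign σ : ℤ) : K) * ∏ i : Fin m, A (σ (pairFst h i)) (σ (pairSnd h i))

theorem pairFst_ne_pairSnd (h : 2 * m ≤ n) (i j : Fin m) : pairFst h i ≠ pairSnd h j := by
  intro e
  have := congrArg Fin.val e
  simp only [pairFst, pairSnd] at this
  omega

theorem pairFst_injective (h : 2 * m ≤ n) : Function.Injective (pairFst h) := by
  intro i j e
  have := congrArg Fin.val e
  simp only [pairFst] at this
  omega

theorem pairSnd_injective (h : 2 * m ≤ n) : Function.Injective (pairSnd h) := by
  intro i j e
  have := congrArg Fin.val e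
  simp only [pairSnd] at this
  omega

theorem pfTerm_mul_swap (h : 2 * m ≤ n) {A : Fin n → Fin n → K} (hA : ∀ i j, A j i = -A i j)
    (σ : Equiv.Perm (Fin n)) (i : Fin m) :
    pfTerm h A (σ * Equiv.swap (pairFst h i) (pairSnd h i)) = pfTerm h A σ := by
  have h1 : ∀ j ∈ Finset.univ.erase i,
      A ((σ * Equiv.swap (pairFst h i) (pairSnd h i)) (pairFst h j))
        ((σ * Equiv.swap (pairFst h i) (pairSnd h i)) (pairSnd h j)) =
      A (σ (pairFst h j)) (σ (pairSnd h j)) := by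
    intro j hj
    have hji := Finset.ne_of_mem_erase hj
    rw [Equiv.Perm.mul_apply, Equiv.Perm.mul_apply,
      Equiv.swap_apply_of_ne_of_ne ((pairFst_injective h).ne hji) (pairFst_ne_pairSnd h j i),
      Equiv.swap_apply_of_ne_of_ne (pairFst_ne_pairSnd h i j).symm ((pairSnd_injective h).ne hji)]
  rw [pfTerm, pfTerm, ← Finset.mul_prod_erase _ _ (Finset.mem_univ i),
    ← Finset.mul_prod_erase _ (fun j => A (σ (pairFst h j)) (σ (pairSnd h j))) (Finset.mem_univ i),
    Finset.prod_congr rfl h1, Equiv.Perm.mul_apply, Equiv.Perm.mul_apply, Equiv.swap_apply_left,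
    Equiv.swap_apply_right, hA (σ (pairFst h i)), Equiv.Perm.sign_mul,
    Equiv.Perm.sign_swap (pairFst_ne_pairSnd h i i)]
  simp

theorem pfTerm_mul_swap_mul_swap (h : 2 * m ≤ n) (A : Fin n → Fin n → K)
    (σ : Equiv.Perm (Fin n)) {i j : Fin m} (hij : i ≠ j) :
    pfTerm h A (σ * (Equiv.swap (pairFst h i) (pairFst h j) *
      Equiv.swap (pairSnd h i) (pairSnd h j))) = pfTerm h A σ := by
  have e1 : ∀ k, (Equiv.swap (pairFst h i) (pairFst h j) *
      Equiv.swap (pairSnd h i) (pairSnd h j)) (pairFst h k) = pairFst h (Equiv.swap i j k) := by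
    intro k
    rw [Equiv.Perm.mul_apply, Equiv.swap_apply_of_ne_of_ne (pairFst_ne_pairSnd h k i)
      (pairFst_ne_pairSnd h k j), (pairFst_injective h).swap_apply]
  have e2 : ∀ k, (Equiv.swap (pairFst h i) (pairFst h j) *
      Equiv.swap (pairSnd h i) (pairSnd h j)) (pairSnd h k) = pairSnd h (Equiv.swap i j k) := by
    intro k
    rw [Equiv.Perm.mul_apply, (pairSnd_injective h).swap_apply, Equiv.swap_apply_of_ne_of_ne
      (pairFst_ne_pairSnd h i _).symm (pairFst_ne_pairSnd h j _).symm]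
  simp only [pfTerm, Equiv.Perm.mul_apply σ, e1, e2]
  rw [Equiv.prod_comp (Equiv.swap i j) fun k => A (σ (pairFst h k)) (σ (pairSnd h k)),
    Equiv.Perm.sign_mul, Equiv.Perm.sign_mul, Equiv.Perm.sign_swap ((pairFst_injective h).ne hij),
    Equiv.Perm.sign_swap ((pairSnd_injective h).ne hij)]
  simp

/-- Exchanges inside a pair (by skew-symmetry) and exchanges of two pairs (an even permutation)
preserve each term, and together they move any paired position to position 0. Hence all paired
positions of the index 0 contribute equally. -/
theorem exists_perm_pfTerm_mul (h : 2 * (m + 1) ≤ n + 1) {A : Fin (n + 1) → Fin (n + 1) → K}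
    (hA : ∀ i j, A j i = -A i j) {p : Fin (n + 1)} (hp : (p : ℕ) < 2 * (m + 1)) :
    ∃ π : Equiv.Perm (Fin (n + 1)), π 0 = p ∧ ∀ σ, pfTerm h A (σ * π) = pfTerm h A σ := by
  have h0 : (0 : Fin (n + 1)) = pairFst h 0 := rfl
  have hfst : ∀ i : Fin (m + 1), ∃ π : Equiv.Perm (Fin (n + 1)),
      π 0 = pairFst h i ∧ ∀ σ, pfTerm h A (σ * π) = pfTerm h A σ := by
    intro i
    rcases eq_or_ne 0 i with rfl | hi
    · exact ⟨1, rfl, fun σ => by rw [mul_one]⟩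
    · refine ⟨_, ?_, fun σ => pfTerm_mul_swap_mul_swap h A σ hi⟩
      rw [h0, Equiv.Perm.mul_apply, Equiv.swap_apply_of_ne_of_ne (pairFst_ne_pairSnd h _ _)
        (pairFst_ne_pairSnd h _ _), Equiv.swap_apply_left]
  obtain ⟨i, hi | hi⟩ : ∃ i : Fin (m + 1), p = pairFst h i ∨ p = pairSnd h i := by
    refine ⟨⟨p / 2, by omega⟩, ?_⟩
    simp only [pairFst, pairSnd, Fin.ext_iff]
    omega
  · rw [hi]
    exact hfst i
  · obtain ⟨π, h1, h2⟩ := hfst i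
    refine ⟨Equiv.swap (pairFst h i) (pairSnd h i) * π, ?_, fun σ => ?_⟩
    · rw [Equiv.Perm.mul_apply, h1, Equiv.swap_apply_left, hi]
    · rw [← mul_assoc, h2, pfTerm_mul_swap h hA]

/-- The inverse of `b.cycleRange` sends 0 to b and keeps the order of the rest, so it matches
`Fin.succAbove` and has sign (-1)^b. -/
theorem sum_perm_ite_apply_zero (b : Fin (n + 1)) (F : Equiv.Perm (Fin (n + 1)) → K) :
    ∑ σ, (if σ 0 = b then F σ else 0) =
      ∑ e : Equiv.Perm (Fin n), F (b.cycleRange.symm * Equiv.Perm.decomposeFin.symm (0, e)) := by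
  rw [← Equiv.sum_comp (Equiv.mulLeft b.cycleRange.symm),
    ← Equiv.sum_comp Equiv.Perm.decomposeFin.symm, Fintype.sum_prod_type,
    Finset.sum_eq_single 0]
  · refine Finset.sum_congr rfl fun e _ => ?_
    rw [if_pos]
    · rfl
    · rw [Equiv.coe_mulLeft, Equiv.Perm.mul_apply, Equiv.Perm.decomposeFin_symm_apply_zero,
        Fin.cycleRange_symm_zero]
  · intro p _ hp
    refine Finset.sum_eq_zero fun e _ => if_neg ?_
    rw [Equiv.coe_mulLeft, Equiv.Perm.mul_apply, Equiv.Perm.decomposeFin_symm_apply_zero]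
    intro h
    rw [← Fin.cycleRange_symm_zero b] at h
    exact hp (b.cycleRange.symm.injective (by simpa using h))
  · simp

/-- The part of the Pfaffian sum where the index `0` is unpaired. -/
def pfRest (h : 2 * m ≤ n + 1) (A : Fin (n + 1) → Fin (n + 1) → K) : K :=
  ∑ p : Fin (n + 1), if (p : ℕ) < 2 * m then 0 else
    ∑ σ : Equiv.Perm (Fin (n + 1)), if σ p = 0 then pfTerm h A σ else 0

/-- When the index 0 sits at an unpaired position, no entry of its row or column occurs in the term.
-/
theorem pfRest_congr (h : 2 * m ≤ n + 1) {A B : Fin (n + 1) → Fin (n + 1) → K}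
    (hAB : ∀ i j, i ≠ 0 → j ≠ 0 → A i j = B i j) : pfRest h A = pfRest h B := by
  refine Finset.sum_congr rfl fun p _ => ?_
  split_ifs with hp
  · rfl
  · refine Finset.sum_congr rfl fun σ _ => ?_
    split_ifs with hσ
    · simp only [pfTerm]
      congr 1
      refine Finset.prod_congr rfl fun i _ => hAB _ _ ?_ ?_ <;>
      · rw [← hσ]
        refine σ.injective.ne fun e => hp ?_
        rw [← e]
        simp only [pairFst, pairSnd]
        omega
    · rfl

theorem sum_pfTerm_fix_zero (h : 2 * m ≤ n) (h' : 2 * (m + 1) ≤ n + 2)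
    (A : Fin (n + 2) → Fin (n + 2) → K) :
    ∑ σ, (if σ 0 = 0 then pfTerm h' A σ else 0) =
      ∑ b : Fin (n + 1), (-1) ^ (b : ℕ) * A 0 b.succ *
        ∑ e, pfTerm h (fun i j => A (b.succAbove i).succ (b.succAbove j).succ) e := by
  rw [sum_perm_ite_apply_zero]
  have h1 : ∀ F : Equiv.Perm (Fin (n + 1)) → K,
      ∑ e, F e = ∑ b : Fin (n + 1), ∑ e, if e 0 = b then F e else 0 := by
    intro F
    rw [Finset.sum_comm]
    exact Finset.sum_congr rfl fun e _ => by simp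
  rw [h1]
  refine Finset.sum_congr rfl fun b _ => ?_
  rw [sum_perm_ite_apply_zero, Finset.mul_sum]
  refine Finset.sum_congr rfl fun e _ => ?_
  have hc : (Fin.cycleRange (0 : Fin (n + 2))).symm = 1 := by
    rw [Fin.cycleRange_zero]
    rfl
  set ρ := b.cycleRange.symm * Equiv.Perm.decomposeFin.symm (0, e) with hρ
  have hρ0 : ρ 0 = b := by
    rw [hρ, Equiv.Perm.mul_apply, Equiv.Perm.decomposeFin_symm_apply_zero,
      Fin.cycleRange_symm_zero]
  have hρs : ∀ k, ρ k.succ = b.succAbove (e k) := fun k => by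
    rw [hρ, Equiv.Perm.mul_apply, Equiv.Perm.decomposeFin_symm_apply_succ, Equiv.swap_self,
      Equiv.refl_apply, Fin.cycleRange_symm_succ]
  have hs : ∀ k, Equiv.Perm.decomposeFin.symm (0, ρ) k.succ = (ρ k).succ := fun k => by
    rw [Equiv.Perm.decomposeFin_symm_apply_succ, Equiv.swap_self, Equiv.refl_apply]
  have hsign : Equiv.Perm.sign ρ = (-1) ^ (b : ℕ) * Equiv.Perm.sign e := by
    rw [hρ, Equiv.Perm.sign_mul, Equiv.Perm.sign_symm, Fin.sign_cycleRange,
      Equiv.Perm.decomposeFin.symm_sign, if_pos rfl, one_mul]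
  rw [hc, one_mul, pfTerm, pfTerm, Fin.prod_univ_succ, Equiv.Perm.decomposeFin.symm_sign,
    if_pos rfl, one_mul, hsign]
  have p0 : pairFst h' 0 = 0 := rfl
  have p1 : pairSnd h' 0 = Fin.succ 0 := rfl
  have p2 : ∀ i : Fin m, pairFst h' i.succ = (pairFst h i).succ.succ := fun i => by
    ext
    simp only [pairFst, Fin.val_succ]
    ring
  have p3 : ∀ i : Fin m, pairSnd h' i.succ = (pairSnd h i).succ.succ := fun i => by
    ext
    simp only [pairSnd, Fin.val_succ]
    ring
  simp only [p0, p1, p2, p3, hs, hρs, hρ0, Equiv.Perm.decomposeFin_symm_apply_zero]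
  push_cast
  ring

/-- Expansion of a Pfaffian sum along the first row. -/
theorem sum_pfTerm_succ (h : 2 * m ≤ n) (h' : 2 * (m + 1) ≤ n + 2)
    {A : Fin (n + 2) → Fin (n + 2) → K} (hA : ∀ i j, A j i = -A i j) :
    ∑ σ, pfTerm h' A σ = 2 * (m + 1) * (∑ b : Fin (n + 1), (-1) ^ (b : ℕ) * A 0 b.succ *
        ∑ e, pfTerm h (fun i j => A (b.succAbove i).succ (b.succAbove j).succ) e) +
      pfRest h' A := by
  rw [← sum_pfTerm_fix_zero h h' A]
  set S := ∑ σ, (if σ 0 = 0 then pfTerm h' A σ else 0) with hS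
  have h1 : ∑ σ, pfTerm h' A σ =
      ∑ p : Fin (n + 2), ∑ σ, if σ p = 0 then pfTerm h' A σ else 0 := by
    rw [Finset.sum_comm]
    refine Finset.sum_congr rfl fun σ _ => ?_
    rw [Finset.sum_eq_single (σ.symm 0)]
    · simp
    · intro p _ hp
      exact if_neg fun e => hp (σ.injective (by simpa using e))
    · simp
  have h2 : ∀ p : Fin (n + 2), (p : ℕ) < 2 * (m + 1) →
      ∑ σ, (if σ p = 0 then pfTerm h' A σ else 0) = S := by
    intro p hp
    obtain ⟨π, hπ, hinv⟩ := exists_perm_pfTerm_mul h' hA hp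
    rw [hS, ← Equiv.sum_comp (Equiv.mulRight π) fun σ => if σ 0 = 0 then pfTerm h' A σ else 0]
    refine Finset.sum_congr rfl fun σ _ => ?_
    rw [Equiv.coe_mulRight, hinv, Equiv.Perm.mul_apply, hπ]
  have h3 : ∀ p : Fin (n + 2), ∑ σ, (if σ p = 0 then pfTerm h' A σ else 0) =
      (if (p : ℕ) < 2 * (m + 1) then S else 0) + if (p : ℕ) < 2 * (m + 1) then 0 else
        ∑ σ : Equiv.Perm (Fin (n + 2)), if σ p = 0 then pfTerm h' A σ else 0 := by
    intro p
    split_ifs with hp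
    · rw [h2 p hp, add_zero]
    · rw [zero_add]
  rw [h1, Finset.sum_congr rfl fun p _ => h3 p, Finset.sum_add_distrib, pfRest]
  congr 1
  rw [← Finset.sum_filter, Finset.sum_const, nsmul_eq_mul]
  congr 1
  rw [Fin.card_filter_val_lt, min_eq_right h']
  push_cast
  ring

theorem pfRest_eq_zero (A : Fin (n + 1) → Fin (n + 1) → K) (h : 2 * m = n + 1) :
    pfRest h.le A = 0 :=
  Finset.sum_eq_zero fun p _ => if_pos (by omega)

/-- A Pfaffian sum with two equal rows vanishes. -/
theorem sum_pfTerm_eq_zero [CharZero K] (h : 2 * m ≤ n) {ι : Type*} (A : ι → ι → K) {r : Fin n → ι}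
    {i j : Fin n} (hij : i ≠ j) (hr : r i = r j) :
    ∑ σ, pfTerm h (fun a b => A (r a) (r b)) σ = 0 := by
  have hswap : ∀ k, r (Equiv.swap i j k) = r k := by
    intro k
    by_cases hk : k = i
    · rw [hk, Equiv.swap_apply_left, hr]
    · by_cases hk' : k = j
      · rw [hk', Equiv.swap_apply_right, hr]
      · rw [Equiv.swap_apply_of_ne_of_ne hk hk']
  have h1 : ∀ σ : Equiv.Perm (Fin n), pfTerm h (fun a b => A (r a) (r b)) (Equiv.swap i j * σ) =
      -pfTerm h (fun a b => A (r a) (r b)) σ := by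
    intro σ
    simp only [pfTerm, Equiv.Perm.mul_apply, hswap, Equiv.Perm.sign_mul,
      Equiv.Perm.sign_swap hij]
    simp
  have h2 := Equiv.sum_comp (Equiv.mulLeft (Equiv.swap i j))
    fun σ => pfTerm h (fun a b => A (r a) (r b)) σ
  simp only [Equiv.coe_mulLeft, h1, Finset.sum_neg_distrib] at h2
  exact self_eq_neg.1 h2.symm

end

/-! ### Pfaffian evaluations from the four-term relation -/

section
variable {K X : Type*} [Field K] {f g : X → X → K} {τ : X → X} {c e κ : K} {m n : ℕ}

/-- The normalized Pfaffian sum of a matrix of size `n ≥ 2m`. -/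
def pf (h : 2 * m ≤ n) (A : Fin n → Fin n → K) : K :=
  1 / (2 ^ m * (Nat.factorial m : K)) * ∑ σ, pfTerm h A σ

theorem pf_succ [CharZero K] (h : 2 * m ≤ n) (h' : 2 * (m + 1) ≤ n + 2)
    {A : Fin (n + 2) → Fin (n + 2) → K} (hA : ∀ i j, A j i = -A i j) :
    pf h' A = ∑ b : Fin (n + 1), (-1) ^ (b : ℕ) * A 0 b.succ *
        pf h (fun i j => A (b.succAbove i).succ (b.succAbove j).succ) +
      1 / (2 ^ (m + 1) * (Nat.factorial (m + 1) : K)) * pfRest h' A := by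
  rw [pf, sum_pfTerm_succ h h' hA, mul_add, Finset.mul_sum, Finset.mul_sum]
  congr 1
  refine Finset.sum_congr rfl fun b _ => ?_
  have h1 : (m : K) + 1 ≠ 0 := by exact_mod_cast Nat.succ_ne_zero m
  have h2 : (Nat.factorial m : K) ≠ 0 := by exact_mod_cast Nat.factorial_ne_zero m
  rw [pf, Nat.factorial_succ]
  push_cast
  rw [pow_succ]
  field_simp

theorem pf_zero (h : 2 * 0 ≤ n) (hn : n ≤ 1) (A : Fin n → Fin n → K) : pf h A = 1 := by
  have : Subsingleton (Fin n) := Fin.subsingleton_iff_le_one.2 hn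
  simp [pf, pfTerm]

/-- The product of `f (u i) (u j)` over `i < j`. -/
def pairProd (f : X → X → K) (u : Fin n → X) : K := ∏ i, ∏ j ∈ Finset.Ioi i, f (u i) (u j)

theorem pairProd_succ (f : X → X → K) (u : Fin (n + 1) → X) :
    pairProd f u = (∏ j : Fin n, f (u 0) (u j.succ)) * pairProd f (fun i => u i.succ) := by
  rw [pairProd, Fin.prod_univ_succ, Fin.prod_Ioi_zero, pairProd]
  congr 1
  exact Finset.prod_congr rfl fun i _ => Fin.prod_Ioi_succ (fun j => f (u i.succ) (u j)) i

theorem pairProd_succAbove (hf : ∀ a b, f b a = -f a b) (u : Fin (n + 1) → X) (b : Fin (n + 1)) :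
    pairProd f u = (-1) ^ (b : ℕ) * (∏ j : Fin n, f (u b) (u (b.succAbove j))) *
      pairProd f (fun i => u (b.succAbove i)) := by
  induction n with
  | zero =>
    have hb : b = 0 := Fin.fin_one_eq_zero b
    simp [pairProd, hb]
  | succ n ih =>
    refine Fin.cases ?_ (fun b => ?_) b
    · rw [pairProd_succ]
      simp
    · rw [pairProd_succ, ih (fun i => u i.succ) b, pairProd_succ f fun i => u (b.succ.succAbove i),
        Fin.prod_univ_succAbove _ b, Fin.prod_univ_succ]
      simp only [Fin.succ_succAbove_zero, Fin.succ_succAbove_succ, Fin.val_succ]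
      rw [hf (u 0) (u b.succ)]
      ring

theorem prod_erase_eq_prod_succAbove (G : Fin (n + 1) → K) (b : Fin (n + 1)) :
    ∏ j ∈ Finset.univ.erase b, G j = ∏ j, G (b.succAbove j) := by
  have : Finset.univ.erase b = Finset.univ.image b.succAbove := by
    ext j
    simp
  rw [this, Finset.prod_image fun i _ j _ hij => Fin.succAbove_right_injective hij]

/-- Turns the signed cofactors of a first-row expansion into the summands of the partial fraction
identity. -/
theorem neg_one_pow_mul_pairProd_succAbove (hf : ∀ a b, f b a = -f a b) {u : Fin (n + 1) → X}
    (hu : ∀ i j, i ≠ j → f (u i) (u j) ≠ 0) (b : Fin (n + 1)) :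
    (-1) ^ (b : ℕ) * pairProd f (fun i => u (b.succAbove i)) =
      pairProd f u * ∏ j ∈ Finset.univ.erase b, (f (u b) (u j))⁻¹ := by
  have h0 : ∏ j, f (u b) (u (b.succAbove j)) ≠ 0 :=
    Finset.prod_ne_zero_iff.2 fun j _ => hu _ _ (Fin.succAbove_ne b j).symm
  rw [pairProd_succAbove hf u b, prod_erase_eq_prod_succAbove, Finset.prod_inv_distrib]
  field_simp

theorem FourTermRelation.pf_eq [CharZero K] (hf : FourTermRelation f τ c e) (hn : n = 2 * m)
    {u : Fin n → X} (hu : ∀ i j, i ≠ j → f (u i) (u j) ≠ 0) :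
    pf hn.ge (fun i j => f (u i) (u j)) = c ^ m.choose 2 * pairProd f u := by
  induction m generalizing n with
  | zero =>
    rw [pf_zero _ (by omega)]
    subst hn
    simp [pairProd]
  | succ m ih =>
    obtain ⟨n, rfl⟩ : ∃ n', n = n' + 2 := ⟨2 * m, hn⟩
    have hn' : n = 2 * m := by omega
    set v : Fin (n + 1) → X := fun i => u i.succ with hv
    have hvne : ∀ i j, i ≠ j → f (v i) (v j) ≠ 0 := fun i j hij =>
      hu _ _ ((Fin.succ_injective _).ne hij)
    have hu0 : pairProd f u = (∏ j, f (u 0) (v j)) * pairProd f v := pairProd_succ f u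
    rw [pf_succ hn'.ge _ (fun i j => hf.swap _ _), pfRest_eq_zero _ (by omega), mul_zero,
      add_zero]
    have h1 : ∀ b ∈ (Finset.univ : Finset (Fin (n + 1))), (-1) ^ (b : ℕ) * f (u 0) (u b.succ) *
        pf hn'.ge (fun i j => f (u (b.succAbove i).succ) (u (b.succAbove j).succ)) =
        c ^ m.choose 2 * pairProd f v *
          (f (u 0) (v b) * ∏ j ∈ Finset.univ.erase b, (f (v b) (v j))⁻¹) := by
      intro b _
      rw [ih hn' (u := fun i => v (b.succAbove i))
        fun i j hij => hvne _ _ (Fin.succAbove_right_injective.ne hij)]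
      linear_combination c ^ m.choose 2 * f (u 0) (v b) *
        neg_one_pow_mul_pairProd_succAbove hf.swap hvne b
    rw [Finset.sum_congr rfl h1, ← Finset.mul_sum,
      hf.sum_eq_prod m (by simp [hn']) (fun i _ j _ hij => hvne i j hij) (u 0)
        (fun i _ => hu _ _ (Fin.succ_ne_zero i).symm), hu0, Nat.choose_succ_succ' m 1,
      Nat.choose_one_right, pow_add]
    ring

theorem FourTermRelation.pf_eq_of_three_term [CharZero K] (hf : FourTermRelation f τ c e)
    (hg : ∀ a b, g b a = -g a b)
    (hgf : ∀ a b d, f a b ≠ 0 → f a d ≠ 0 → f b d ≠ 0 →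
      g a b - g a d + g b d = κ * (f a b * f a d * f b d))
    (hn : n = 2 * m + 1) {u : Fin n → X} (hu : ∀ i j, i ≠ j → f (u i) (u j) ≠ 0)
    (hmn : 2 * m ≤ n) :
    pf hmn (fun i j => g (u i) (u j)) = κ ^ m * c ^ m.choose 2 * pairProd f u := by
  induction m generalizing n with
  | zero =>
    rw [pf_zero _ (by omega)]
    subst hn
    simp [pairProd]
  | succ m ih =>
    obtain ⟨n, rfl⟩ : ∃ n', n = n' + 2 := ⟨2 * m + 1, hn⟩
    have hn' : n = 2 * m + 1 := by omega
    have hmn' : 2 * m ≤ n := by omega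
    set v : Fin (n + 1) → X := fun i => u i.succ with hv
    set l : Fin (n + 1) := Fin.last n
    have hvne : ∀ i j, i ≠ j → f (v i) (v j) ≠ 0 := fun i j hij =>
      hu _ _ ((Fin.succ_injective _).ne hij)
    have h0v : ∀ i, f (u 0) (v i) ≠ 0 := fun i => hu _ _ (Fin.succ_ne_zero i).symm
    have hu0 : pairProd f u = (∏ j, f (u 0) (v j)) * pairProd f v := pairProd_succ f u
    set P : Fin (n + 1) → K := fun b =>
      pf hmn' (fun i j => g (v (b.succAbove i)) (v (b.succAbove j))) with hP
    have hPb : ∀ b : Fin (n + 1), (-1) ^ (b : ℕ) * P b = κ ^ m * c ^ m.choose 2 * pairProd f v *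
        ∏ j ∈ Finset.univ.erase b, (f (v b) (v j))⁻¹ := by
      intro b
      simp only [hP]
      rw [ih hn' (u := fun i => v (b.succAbove i))
        (fun i j hij => hvne _ _ (Fin.succAbove_right_injective.ne hij))]
      linear_combination κ ^ m * c ^ m.choose 2 *
        neg_one_pow_mul_pairProd_succAbove hf.swap hvne b
    -- This vanishing allows any constant to be added to the first row, here -g(u_0, v_l).
    have hsum : ∑ b : Fin (n + 1), (-1) ^ (b : ℕ) * P b = 0 := by
      rw [Finset.sum_congr rfl fun b _ => hPb b, ← Finset.mul_sum,
        hf.sum_prod_inv_eq_zero (k := m) (by simp [hn']) (fun i _ j _ hij => hvne i j hij),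
        mul_zero]
    have hA := pf_succ hmn' hmn (A := fun i j => g (u i) (u j)) fun i j => hg _ _
    -- The first point is replaced by a copy of the last: the Pfaffian vanishes, while the remainder
    -- and the cofactors stay the same.
    set r : Fin (n + 2) → X := Fin.cons (v l) v with hr
    have hB := pf_succ hmn' hmn (A := fun i j => g (r i) (r j)) fun i j => hg _ _
    have hB0 : pf hmn (fun i j => g (r i) (r j)) = 0 := by
      rw [pf, sum_pfTerm_eq_zero hmn g (Fin.succ_ne_zero l) (by simp [hr]), mul_zero]
    have hrest : pfRest hmn (fun i j => g (r i) (r j)) = pfRest hmn (fun i j => g (u i) (u j)) := by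
      refine pfRest_congr hmn fun i j hi hj => ?_
      obtain ⟨i, rfl⟩ := Fin.exists_succ_eq.2 hi
      obtain ⟨j, rfl⟩ := Fin.exists_succ_eq.2 hj
      simp [hr, hv]
    rw [hB0, hrest] at hB
    simp only [hr, Fin.cons_zero, Fin.cons_succ] at hB
    have hgl : g (v l) (v l) = 0 := self_eq_neg.1 (hg (v l) (v l))
    -- The factor f(v_b, v_l) from the three-term relation cancels the factor j = l of the product,
    -- leaving partial fractions on the 2m+1 points other than l. The summand b = l is zero on its
    -- own.
    have hterm : ∀ b ∈ Finset.univ.erase l,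
        (g (u 0) (v b) - g (u 0) (v l) + g (v b) (v l)) * ((-1) ^ (b : ℕ) * P b) =
        κ ^ (m + 1) * c ^ m.choose 2 * pairProd f v * f (u 0) (v l) *
          (f (u 0) (v b) * ∏ j ∈ (Finset.univ.erase l).erase b, (f (v b) (v j))⁻¹) := by
      intro b hb
      have hbl := Finset.ne_of_mem_erase hb
      have hl : l ∈ Finset.univ.erase b := Finset.mem_erase.2 ⟨hbl.symm, Finset.mem_univ _⟩
      rw [hgf _ _ _ (h0v b) (h0v l) (hvne b l hbl), hPb, ← Finset.mul_prod_erase _ _ hl,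
        Finset.erase_right_comm]
      have := hvne b l hbl
      rw [pow_succ]
      field_simp
    have key : pf hmn (fun i j => g (u i) (u j)) =
        ∑ b : Fin (n + 1), (g (u 0) (v b) - g (u 0) (v l) + g (v b) (v l)) * ((-1) ^ (b : ℕ) * P b) := by
      have e1 : ∑ b : Fin (n + 1), (g (u 0) (v b) - g (u 0) (v l) + g (v b) (v l)) * ((-1) ^ (b : ℕ) * P b) =
          ∑ b : Fin (n + 1), (-1) ^ (b : ℕ) * g (u 0) (v b) * P b - g (u 0) (v l) * ∑ b : Fin (n + 1), (-1) ^ (b : ℕ) * P b -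
          ∑ b : Fin (n + 1), (-1) ^ (b : ℕ) * g (v l) (v b) * P b := by
        rw [Finset.mul_sum, ← Finset.sum_sub_distrib, ← Finset.sum_sub_distrib]
        refine Finset.sum_congr rfl fun b _ => ?_
        rw [hg (v l) (v b)]
        ring
      rw [e1, hsum]
      linear_combination hA - hB
    rw [key, ← Finset.add_sum_erase _ _ (Finset.mem_univ l), hgl, sub_self, zero_add, zero_mul,
      zero_add, Finset.sum_congr rfl hterm, ← Finset.mul_sum,
      hf.sum_eq_prod m (by simp [Finset.card_erase_of_mem, hn'])
        (fun i _ j _ hij => hvne i j hij) (u 0) (fun i _ => h0v i), hu0,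
      ← Finset.mul_prod_erase _ _ (Finset.mem_univ l), Nat.choose_succ_succ' m 1,
      Nat.choose_one_right, pow_add]
    ring

end

/-! ### Monomial factors in Pfaffians and in products over pairs -/

section
variable {K X : Type*} [Field K] {m n : ℕ}

theorem prod_pairs (hn : n = 2 * m) (s : Fin n → K) :
    ∏ i : Fin m, s (pairFst hn.ge i) * s (pairSnd hn.ge i) = ∏ k, s k := by
  induction m generalizing n with
  | zero =>
    subst hn
    simp
  | succ m ih =>
    obtain ⟨n, rfl⟩ : ∃ n', n = n' + 2 := ⟨2 * m, hn⟩
    have hn' : n = 2 * m := by omega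
    rw [Fin.prod_univ_succ, Fin.prod_univ_succ, Fin.prod_univ_succ, ← ih hn', ← mul_assoc]
    rfl

theorem pf_mul_mul (hn : n = 2 * m) (s : Fin n → K) (A : Fin n → Fin n → K) :
    pf hn.ge (fun i j => s i * s j * A i j) = (∏ i, s i) * pf hn.ge A := by
  have h1 : ∀ σ, pfTerm hn.ge (fun i j => s i * s j * A i j) σ =
      (∏ i, s i) * pfTerm hn.ge A σ := by
    intro σ
    rw [pfTerm, Finset.prod_mul_distrib, prod_pairs hn fun k => s (σ k), Equiv.prod_comp σ s, pfTerm]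
    ring
  rw [pf, Finset.sum_congr rfl fun σ _ => h1 σ, ← Finset.mul_sum, pf]
  ring

theorem pairProd_mul (f g : X → X → K) (u : Fin n → X) :
    pairProd (fun a b => f a b * g a b) u = pairProd f u * pairProd g u := by
  simp only [pairProd, Finset.prod_mul_distrib]

/-- With 0-based i, w_i is a numerator for i pairs and a denominator for n - 1 - i pairs. -/
theorem pairProd_div (w : Fin n → Kˣ) :
    pairProd (fun a b : Kˣ => (b / a : K)) w = ∏ i, (w i : K) ^ (2 * (i : ℕ) + 1 - n : ℤ) := by
  induction n with
  | zero => simp [pairProd]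
  | succ n ih =>
    rw [pairProd_succ, ih, Fin.prod_univ_succ, Finset.prod_div_distrib, Finset.prod_const,
      Finset.card_univ, Fintype.card_fin, div_mul_eq_mul_div, ← Finset.prod_mul_distrib,
      div_eq_inv_mul]
    congr 1
    · rw [← zpow_natCast, ← zpow_neg]
      congr 1
      simp
    · refine Finset.prod_congr rfl fun i _ => ?_
      rw [← zpow_one_add₀ (w i.succ).ne_zero]
      congr 1
      push_cast [Fin.val_succ]
      ring

end

/-! ### The evaluations for theta functions at generic points -/

section
variable {q p : ℂ} {m n : ℕ}

theorem fourTermRelation_qSn (hp0 : p ≠ 0) (hq : ‖q‖ < 1) (hpq : q = p * p) {r : ℂˣ}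
    (hr : (r : ℂ) * r = p) :
    FourTermRelation (fun a b : ℂˣ => qSn q p a b) (fun a => r * a) p (-(r : ℂ)⁻¹) where
  swap a b := qSn_swap hp0 hq hpq a.ne_zero b.ne_zero
  four_term a b c d := qSn_four_term hp0 hq hpq a.ne_zero b.ne_zero c.ne_zero d.ne_zero
  shift a b := by
    rw [Units.val_mul]
    exact qSn_shift hp0 hq hpq hr a.ne_zero b.ne_zero
  mul_eq_one := by
    rw [← hr]
    field_simp

/-- Obtained by differentiating the symmetry θ(p/z) = θ(pz). -/
theorem qZeta_swap (hp0 : p ≠ 0) (hq : ‖q‖ < 1) (hpq : q = p * p) {a b : ℂ} (ha : a ≠ 0)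
    (hb : b ≠ 0) : qZeta q p b a = -qZeta q p a b := by
  have hz : a ^ 2 / b ^ 2 ≠ 0 := div_ne_zero (pow_ne_zero 2 ha) (pow_ne_zero 2 hb)
  rw [qZeta, qZeta, ← inv_div (a ^ 2) (b ^ 2), qTheta_mul_inv hp0 hpq]
  generalize a ^ 2 / b ^ 2 = z at *
  have h1 : HasDerivAt (fun z => qTheta q (p * z⁻¹)) (qThetaDeriv q (p * z⁻¹) * (p * -(z ^ 2)⁻¹)) z :=
    HasDerivAt.comp z (h₂ := qTheta q) (hasDerivAt_qTheta hq (mul_ne_zero hp0 (inv_ne_zero hz)))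
      ((hasDerivAt_inv hz).const_mul p)
  have h2 : HasDerivAt (fun z => qTheta q (p * z)) (qThetaDeriv q (p * z) * p) z :=
    HasDerivAt.comp z (h₂ := qTheta q) (hasDerivAt_qTheta hq (mul_ne_zero hp0 hz))
      (by simpa using (hasDerivAt_id z).const_mul p)
  simp only [qTheta_mul_inv hp0 hpq] at h1
  have h := h1.unique h2
  have h3 : qThetaDeriv q (p * z⁻¹) = -(z ^ 2 * qThetaDeriv q (p * z)) := by
    field_simp at h
    rw [← div_eq_mul_inv]
    linear_combination -h
  rw [h3]
  field_simp

theorem qTheta_half (hp0 : p ≠ 0) (hpq : q = p * p) : qTheta q p = qPoch q p ^ 2 := by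
  rw [qTheta, hpq, mul_div_assoc, div_self hp0, mul_one, pow_two]

theorem qTheta_half_ne_zero (hp0 : p ≠ 0) (hp : ‖p‖ < 1) (hpq : q = p * p) : qTheta q p ≠ 0 := by
  have hq : ‖q‖ < 1 := by
    rw [hpq, norm_mul]
    exact mul_lt_one_of_nonneg_of_lt_one_left (norm_nonneg p) hp hp.le
  rw [qTheta_half hp0 hpq]
  refine pow_ne_zero 2 fun h => ?_
  obtain ⟨j, hj⟩ := (qPoch_eq_zero_iff hq p).1 h
  have h1 : ‖p * q ^ j‖ < 1 := by
    rw [norm_mul, norm_pow]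
    exact mul_lt_one_of_nonneg_of_lt_one_left (norm_nonneg p) hp
      (pow_le_one₀ (norm_nonneg q) hq.le)
  rw [hj, norm_one] at h1
  exact lt_irrefl _ h1

theorem thetaRatio_eq {a b : ℂ} (ha : a ≠ 0) (hb : b ≠ 0) :
    qTheta q (b ^ 2 / a ^ 2) / qTheta q (p * b ^ 2 / a ^ 2) = qSn q p a b * (b / a) := by
  rw [qSn, mul_div_assoc]
  field_simp

theorem qSn_ne_zero {a b : ℂ} (ha : a ≠ 0) (hb : b ≠ 0) (h1 : qTheta q (b ^ 2 / a ^ 2) ≠ 0)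
    (h2 : qTheta q (p * b ^ 2 / a ^ 2) ≠ 0) : qSn q p a b ≠ 0 := by
  rw [mul_div_assoc] at h2
  exact mul_ne_zero (div_ne_zero ha hb) (div_ne_zero h1 h2)

/-- The even Pfaffian evaluation at squares of units that are pairwise inequivalent. -/
theorem pf_theta_even_of_generic (hp0 : p ≠ 0) (hq : ‖q‖ < 1) (hpq : q = p * p) (hn : n = 2 * m)
    (w : Fin n → ℂˣ) (h1 : ∀ i j, i ≠ j → qTheta q ((w j : ℂ) ^ 2 / (w i : ℂ) ^ 2) ≠ 0)
    (h2 : ∀ i j, i ≠ j → qTheta q (p * (w j : ℂ) ^ 2 / (w i : ℂ) ^ 2) ≠ 0) :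
    pf hn.ge (fun i j => qTheta q ((w j : ℂ) ^ 2 / (w i : ℂ) ^ 2) /
        ((w j : ℂ) ^ 2 * qTheta q (p * (w j : ℂ) ^ 2 / (w i : ℂ) ^ 2))) =
      p ^ m.choose 2 * (∏ i, ((w i : ℂ) ^ 2) ^ ((m : ℤ) - ((i : ℕ) + 1 : ℤ))) *
        ∏ i, ∏ j ∈ Finset.Ioi i, qTheta q ((w j : ℂ) ^ 2 / (w i : ℂ) ^ 2) /
          qTheta q (p * (w j : ℂ) ^ 2 / (w i : ℂ) ^ 2) := by
  obtain ⟨r, hr⟩ : ∃ r : ℂ, p = r * r := by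
    obtain ⟨r, hr⟩ := IsAlgClosed.exists_pow_nat_eq p two_pos
    exact ⟨r, by rw [← hr, pow_two]⟩
  have hr0 : r ≠ 0 := by
    rintro rfl
    exact hp0 (by simpa using hr)
  have hf := fourTermRelation_qSn (r := Units.mk0 r hr0) hp0 hq hpq hr.symm
  have hentry : ∀ i j, qTheta q ((w j : ℂ) ^ 2 / (w i : ℂ) ^ 2) /
      ((w j : ℂ) ^ 2 * qTheta q (p * (w j : ℂ) ^ 2 / (w i : ℂ) ^ 2)) =
      (w i : ℂ)⁻¹ * (w j : ℂ)⁻¹ * qSn q p (w i) (w j) := by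
    intro i j
    rw [div_mul_eq_div_div_swap, thetaRatio_eq (w i).ne_zero (w j).ne_zero]
    have := (w i).ne_zero
    have := (w j).ne_zero
    field_simp
  have hprod : ∏ i, ∏ j ∈ Finset.Ioi i, qTheta q ((w j : ℂ) ^ 2 / (w i : ℂ) ^ 2) /
      qTheta q (p * (w j : ℂ) ^ 2 / (w i : ℂ) ^ 2) =
      pairProd (fun a b : ℂˣ => qSn q p a b * ((b : ℂ) / a)) w :=
    Finset.prod_congr rfl fun i _ => Finset.prod_congr rfl fun j _ =>
      thetaRatio_eq (w i).ne_zero (w j).ne_zero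
  simp only [hentry]
  rw [pf_mul_mul hn fun i => (w i : ℂ)⁻¹, hf.pf_eq hn fun i j hij =>
    qSn_ne_zero (w i).ne_zero (w j).ne_zero (h1 i j hij) (h2 i j hij), hprod, pairProd_mul,
    pairProd_div]
  -- Exponent count for n = 2m and 0-based i: 2(m - i - 1) + (2i + 1 - n) = -1.
  have hw : ∏ i, (w i : ℂ)⁻¹ = (∏ i, ((w i : ℂ) ^ 2) ^ ((m : ℤ) - ((i : ℕ) + 1 : ℤ))) *
      ∏ i : Fin n, (w i : ℂ) ^ (2 * (i : ℕ) + 1 - n : ℤ) := by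
    rw [← Finset.prod_mul_distrib]
    refine Finset.prod_congr rfl fun i _ => ?_
    rw [← zpow_natCast, ← zpow_mul, ← zpow_add₀ (w i).ne_zero, ← zpow_neg_one]
    congr 1
    push_cast
    omega
  rw [hw]
  ring

/-- The odd Pfaffian evaluation at squares of units that are pairwise inequivalent. -/
theorem pf_theta_odd_of_generic (hp0 : p ≠ 0) (hp : ‖p‖ < 1) (hq : ‖q‖ < 1) (hpq : q = p * p)
    (hn : n = 2 * m + 1) (hmn : 2 * m ≤ n)
    (w : Fin n → ℂˣ) (h1 : ∀ i j, i ≠ j → qTheta q ((w j : ℂ) ^ 2 / (w i : ℂ) ^ 2) ≠ 0)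
    (h2 : ∀ i j, i ≠ j → qTheta q (p * (w j : ℂ) ^ 2 / (w i : ℂ) ^ 2) ≠ 0) :
    pf hmn (fun i j => qZeta q p (w i) (w j)) =
      p ^ m.choose 2 * (qPoch q q ^ (2 * m) / qPoch q p ^ (2 * m)) *
        (∏ i, ((w i : ℂ) ^ 2) ^ ((m : ℤ) + 1 - ((i : ℕ) + 1 : ℤ))) *
        ∏ i, ∏ j ∈ Finset.Ioi i, qTheta q ((w j : ℂ) ^ 2 / (w i : ℂ) ^ 2) /
          qTheta q (p * (w j : ℂ) ^ 2 / (w i : ℂ) ^ 2) := by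
  obtain ⟨r, hr⟩ : ∃ r : ℂ, p = r * r := by
    obtain ⟨r, hr⟩ := IsAlgClosed.exists_pow_nat_eq p two_pos
    exact ⟨r, by rw [← hr, pow_two]⟩
  have hr0 : r ≠ 0 := by
    rintro rfl
    exact hp0 (by simpa using hr)
  have hf := fourTermRelation_qSn (r := Units.mk0 r hr0) hp0 hq hpq hr.symm
  have hprod : ∏ i, ∏ j ∈ Finset.Ioi i, qTheta q ((w j : ℂ) ^ 2 / (w i : ℂ) ^ 2) /
      qTheta q (p * (w j : ℂ) ^ 2 / (w i : ℂ) ^ 2) =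
      pairProd (fun a b : ℂˣ => qSn q p a b * ((b : ℂ) / a)) w :=
    Finset.prod_congr rfl fun i _ => Finset.prod_congr rfl fun j _ =>
      thetaRatio_eq (w i).ne_zero (w j).ne_zero
  rw [hf.pf_eq_of_three_term (g := fun a b : ℂˣ => qZeta q p a b)
    (κ := qPoch q q ^ 2 / qPoch q p ^ 2)
    (fun a b => qZeta_swap hp0 hq hpq a.ne_zero b.ne_zero)
    (fun a b d hab had hbd => by
      rw [← qTheta_half hp0 hpq]
      exact qZeta_three_term hp0 hq hpq a.ne_zero b.ne_zero d.ne_zero hab had hbd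
        (qTheta_half_ne_zero hp0 hp hpq)) hn (fun i j hij =>
    qSn_ne_zero (w i).ne_zero (w j).ne_zero (h1 i j hij) (h2 i j hij)) hmn, hprod, pairProd_mul,
    pairProd_div]
  have hw : (∏ i, ((w i : ℂ) ^ 2) ^ ((m : ℤ) + 1 - ((i : ℕ) + 1 : ℤ))) *
      ∏ i : Fin n, (w i : ℂ) ^ (2 * (i : ℕ) + 1 - n : ℤ) = 1 := by
    rw [← Finset.prod_mul_distrib]
    refine Finset.prod_eq_one fun i _ => ?_
    rw [← zpow_natCast, ← zpow_mul, ← zpow_add₀ (w i).ne_zero, ← zpow_zero (w i : ℂ)]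
    congr 1
    push_cast
    omega
  rw [pow_mul, pow_mul, ← div_pow]
  linear_combination (-((qPoch q q ^ 2 / qPoch q p ^ 2) ^ m * p ^ m.choose 2 *
    pairProd (fun a b : ℂˣ => qSn q p a b) w)) * hw

end

/-! ### Removing the genericity assumption -/

section
variable {m n : ℕ}

theorem mem_closure_generic {q : ℂ} (hq0 : q ≠ 0) (hq : ‖q‖ < 1) {x : Fin n → ℂ}
    (hx : ∀ i, x i ≠ 0) :
    x ∈ closure {y : Fin n → ℂ | ∀ i j, i ≠ j → qTheta q (y j / y i) ≠ 0} := by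
  -- Along this curve the coordinates scale at different rates, so each equation y_j/y_i = q^k with
  -- i ≠ j holds for at most one t, and only countably many t are bad.
  set y : ℝ → Fin n → ℂ := fun t i => x i * (Real.exp (t * (i : ℕ)) : ℂ) with hy
  have hy0 : y 0 = x := by
    funext i
    simp [hy]
  have hyc : Continuous y := by
    refine continuous_pi fun i => continuous_const.mul (Complex.continuous_ofReal.comp ?_)
    fun_prop
  have hyne : ∀ t i, y t i ≠ 0 := fun t i =>
    mul_ne_zero (hx i) (Complex.ofReal_ne_zero.2 (Real.exp_ne_zero _))
  set B : Set ℝ := ⋃ (i : Fin n) (j : Fin n) (k : ℤ), {t | i ≠ j ∧ y t j / y t i = q ^ k} with hB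
  have hBc : B.Countable := by
    refine Set.countable_iUnion fun i => Set.countable_iUnion fun j => Set.countable_iUnion fun k =>
      Set.Subsingleton.countable ?_
    rintro s ⟨hij, hs⟩ t ⟨-, ht⟩
    rw [← ht] at hs
    have e : ∀ t, y t j / y t i = x j / x i * (Real.exp (t * ((j : ℕ) - (i : ℕ))) : ℂ) := by
      intro t
      rw [mul_sub, Real.exp_sub, Complex.ofReal_div, hy, mul_div_mul_comm]
    rw [e, e] at hs
    have h1 := mul_left_cancel₀ (div_ne_zero (hx j) (hx i)) hs
    have h2 := Real.exp_injective (Complex.ofReal_injective h1)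
    refine mul_right_cancel₀ (sub_ne_zero.2 fun h => hij ?_) h2
    exact (Fin.ext (by exact_mod_cast h)).symm
  rw [← hy0]
  refine map_mem_closure hyc (hBc.dense_compl ℝ 0) fun t ht i j hij h0 => ht ?_
  obtain ⟨k, hk⟩ := (qTheta_eq_zero_iff hq0 hq (div_ne_zero (hyne t j) (hyne t i))).1 h0
  simp only [hB, Set.mem_iUnion]
  exact ⟨i, j, k, hij, hk⟩

theorem continuousAt_pf {x : Fin n → ℂ} (h : 2 * m ≤ n) {A : (Fin n → ℂ) → Fin n → Fin n → ℂ}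
    (hA : ∀ i j, ContinuousAt (fun y => A y i j) x) : ContinuousAt (fun y => pf h (A y)) x :=
  continuousAt_const.mul (tendsto_finsetSum _ fun _ _ =>
    continuousAt_const.mul (tendsto_finsetProd _ fun _ _ => hA _ _))

theorem eq_of_generic {q p : ℂ} (hp0 : p ≠ 0) (hq : ‖q‖ < 1) (hpq : q = p * p)
    {x : Fin n → ℂ} (hx : ∀ i, x i ≠ 0) (hpx : ∀ i j, qTheta q (p * x j / x i) ≠ 0)
    {F G : (Fin n → ℂ) → ℂ} (hF : ContinuousAt F x) (hG : ContinuousAt G x)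
    (h : ∀ w : Fin n → ℂˣ, (∀ i j, i ≠ j → qTheta q ((w j : ℂ) ^ 2 / (w i : ℂ) ^ 2) ≠ 0) →
      (∀ i j, i ≠ j → qTheta q (p * (w j : ℂ) ^ 2 / (w i : ℂ) ^ 2) ≠ 0) →
      F (fun i => (w i : ℂ) ^ 2) = G fun i => (w i : ℂ) ^ 2) : F x = G x := by
  have hq0 : q ≠ 0 := by rw [hpq]; exact mul_ne_zero hp0 hp0
  have hne := mem_closure_iff_nhdsWithin_neBot.1 (mem_closure_generic hq0 hq hx)
  have e1 : ∀ᶠ y in nhds x, ∀ i, y i ≠ 0 :=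
    Filter.eventually_all.2 fun i => (continuous_apply i).continuousAt.eventually_ne (hx i)
  have e2 : ∀ᶠ y in nhds x, ∀ i j, qTheta q (p * y j / y i) ≠ 0 := by
    refine Filter.eventually_all.2 fun i => Filter.eventually_all.2 fun j => ?_
    have hc : ContinuousAt (fun y : Fin n → ℂ => p * y j / y i) x :=
      ContinuousAt.div (continuous_const.mul (continuous_apply j)).continuousAt
      (continuous_apply i).continuousAt (hx i)
    exact (ContinuousAt.comp (f := fun y : Fin n → ℂ => p * y j / y i)
      (continuousAt_qTheta hq (div_ne_zero (mul_ne_zero hp0 (hx j)) (hx i))) hc).eventually_ne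
      (hpx i j)
  refine tendsto_nhds_unique_of_eventuallyEq
    (l := nhdsWithin x {y | ∀ i j, i ≠ j → qTheta q (y j / y i) ≠ 0})
    (hF.tendsto.mono_left nhdsWithin_le_nhds)
    (hG.tendsto.mono_left nhdsWithin_le_nhds) ?_
  filter_upwards [self_mem_nhdsWithin, nhdsWithin_le_nhds e1, nhdsWithin_le_nhds e2]
    with y hy hy0 hpy
  choose w hw using fun i => IsAlgClosed.exists_pow_nat_eq (y i) two_pos
  have hw0 : ∀ i, w i ≠ 0 := fun i h0 => hy0 i (by rw [← hw, h0, zero_pow two_ne_zero])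
  obtain rfl : (fun i => w i ^ 2) = y := funext hw
  exact h (fun i => Units.mk0 (w i) (hw0 i)) hy fun i j _ => hpy i j

theorem continuousAt_qTheta_mul_div {q c : ℂ} (hq : ‖q‖ < 1) (hc : c ≠ 0) {x : Fin n → ℂ}
    (hx : ∀ i, x i ≠ 0) (i j : Fin n) : ContinuousAt (fun y => qTheta q (c * y j / y i)) x :=
  ContinuousAt.comp (f := fun y : Fin n → ℂ => c * y j / y i)
    (continuousAt_qTheta hq (div_ne_zero (mul_ne_zero hc (hx j)) (hx i)))
    (ContinuousAt.div (continuous_const.mul (continuous_apply j)).continuousAt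
      (continuous_apply i).continuousAt (hx i))

theorem continuousAt_qThetaDeriv_mul_div {q c : ℂ} (hq : ‖q‖ < 1) (hc : c ≠ 0) {x : Fin n → ℂ}
    (hx : ∀ i, x i ≠ 0) (i j : Fin n) : ContinuousAt (fun y => qThetaDeriv q (c * y j / y i)) x :=
  ContinuousAt.comp (f := fun y : Fin n → ℂ => c * y j / y i)
    (continuousAt_qThetaDeriv hq (div_ne_zero (mul_ne_zero hc (hx j)) (hx i)))
    (ContinuousAt.div (continuous_const.mul (continuous_apply j)).continuousAt
      (continuous_apply i).continuousAt (hx i))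

theorem continuousAt_qTheta_div {q : ℂ} (hq : ‖q‖ < 1) {x : Fin n → ℂ}
    (hx : ∀ i, x i ≠ 0) (i j : Fin n) : ContinuousAt (fun y => qTheta q (y j / y i)) x := by
  simpa only [one_mul] using continuousAt_qTheta_mul_div hq one_ne_zero hx i j

theorem continuousAt_prod_zpow {x : Fin n → ℂ} (hx : ∀ i, x i ≠ 0) (e : Fin n → ℤ) :
    ContinuousAt (fun y : Fin n → ℂ => ∏ i, y i ^ e i) x :=
  tendsto_finsetProd _ fun i _ =>
    ((continuous_apply i).continuousAt (x := x)).zpow₀ (e i) (Or.inl (hx i))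

theorem continuousAt_prod_thetaRatio {q p : ℂ} (hp0 : p ≠ 0) (hq : ‖q‖ < 1) {x : Fin n → ℂ}
    (hx : ∀ i, x i ≠ 0) (hpx : ∀ i j, qTheta q (p * x j / x i) ≠ 0) :
    ContinuousAt (fun y : Fin n → ℂ => ∏ i, ∏ j ∈ Finset.Ioi i,
      qTheta q (y j / y i) / qTheta q (p * y j / y i)) x :=
  tendsto_finsetProd _ fun i _ => tendsto_finsetProd _ fun j _ =>
    (continuousAt_qTheta_div hq hx i j).div (continuousAt_qTheta_mul_div hq hp0 hx i j) (hpx i j)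

theorem rpow_eq_sqrt_pow_choose {q : ℝ} (hq : 0 ≤ q) (m : ℕ) :
    ((q ^ ((m : ℝ) * ((m : ℝ) - 1) / 4) : ℝ) : ℂ) = (Real.sqrt q : ℂ) ^ m.choose 2 := by
  rw [← Complex.ofReal_pow, Real.sqrt_eq_rpow, ← Real.rpow_natCast, ← Real.rpow_mul hq,
    Nat.cast_choose_two]
  congr 2
  ring

end

/-! ### Both evaluations at arbitrary points -/

theorem mainTheorem3 (q : ℝ) (hq0 : 0 < q) (hq1 : q < 1) (m : ℕ) :
    (∀ x : Fin (2 * m) → ℂ, (∀ i, x i ≠ 0) →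
      (∀ i j, i ≠ j → qTheta (q : ℂ) ((Real.sqrt q : ℂ) * x j / x i) ≠ 0) →
      (thetaMatrixEven q x).transpose = -thetaMatrixEven q x ∧
      pfaffEven m (thetaMatrixEven q x) =
        ((q ^ ((m : ℝ) * ((m : ℝ) - 1) / 4) : ℝ) : ℂ) *
          (∏ i : Fin (2 * m), x i ^ ((m : ℤ) - ((i : ℕ) + 1 : ℤ))) *
          ∏ i : Fin (2 * m), ∏ j ∈ Finset.Ioi i,
            qTheta (q : ℂ) (x j / x i) / qTheta (q : ℂ) ((Real.sqrt q : ℂ) * x j / x i)) ∧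
    (∀ x : Fin (2 * m + 1) → ℂ, (∀ i, x i ≠ 0) →
      (∀ i j, i ≠ j → qTheta (q : ℂ) ((Real.sqrt q : ℂ) * x j / x i) ≠ 0) →
      (thetaMatrixOdd q x).transpose = -thetaMatrixOdd q x ∧
      pfaffOdd m (thetaMatrixOdd q x) =
        ((q ^ ((m : ℝ) * ((m : ℝ) - 1) / 4) : ℝ) : ℂ) *
          (qPoch (q : ℂ) (q : ℂ) ^ (2 * m) / qPoch (q : ℂ) (Real.sqrt q : ℂ) ^ (2 * m)) *
          (∏ i : Fin (2 * m + 1), x i ^ ((m : ℤ) + 1 - ((i : ℕ) + 1 : ℤ))) *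
          ∏ i : Fin (2 * m + 1), ∏ j ∈ Finset.Ioi i,
            qTheta (q : ℂ) (x j / x i) / qTheta (q : ℂ) ((Real.sqrt q : ℂ) * x j / x i)) := by
  have hq : ‖(q : ℂ)‖ < 1 := by rwa [Complex.norm_real, Real.norm_of_nonneg hq0.le]
  have hp0 : (Real.sqrt q : ℂ) ≠ 0 := Complex.ofReal_ne_zero.2 (Real.sqrt_pos.2 hq0).ne'
  have hpq : (q : ℂ) = Real.sqrt q * Real.sqrt q := by
    rw [← Complex.ofReal_mul, Real.mul_self_sqrt hq0.le]
  have hp : ‖(Real.sqrt q : ℂ)‖ < 1 := by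
    rw [Complex.norm_real, Real.norm_of_nonneg (Real.sqrt_nonneg q)]
    rwa [Real.sqrt_lt' one_pos, one_pow]
  rw [rpow_eq_sqrt_pow_choose hq0.le]
  generalize hpdef : (Real.sqrt q : ℂ) = p at *
  -- The diagonal denominators are θ(√q) ≠ 0; they matter because continuity is used for every
  -- matrix entry.
  have hdiag : ∀ {n : ℕ} {x : Fin n → ℂ}, (∀ i, x i ≠ 0) →
      (∀ i j, i ≠ j → qTheta q (p * x j / x i) ≠ 0) → ∀ i j, qTheta q (p * x j / x i) ≠ 0 := by
    intro n x hx hpx i j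
    rcases eq_or_ne i j with rfl | hij
    · rw [mul_div_assoc, div_self (hx i), mul_one]
      exact qTheta_half_ne_zero hp0 hp hpq
    · exact hpx i j hij
  have hsqrt : ∀ {n : ℕ} {x : Fin n → ℂ}, (∀ i, x i ≠ 0) →
      ∃ w : Fin n → ℂ, (∀ i, w i ≠ 0) ∧ x = fun i => w i ^ 2 := by
    intro n x hx
    choose w hw using fun i => IsAlgClosed.exists_pow_nat_eq (x i) two_pos
    exact ⟨w, fun i h0 => hx i (by rw [← hw, h0, zero_pow two_ne_zero]), (funext hw).symm⟩
  have hodd : ∀ {n : ℕ} (w : Fin n → ℂ) (i j : Fin n),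
      thetaMatrixOdd q (fun i => w i ^ 2) i j = qZeta q p (w i) (w j) := by
    intro n w i j
    rw [thetaMatrixOdd, hpdef, Matrix.of_apply, mul_div_mul_comm, mul_div_assoc, qZeta]
  refine ⟨fun x hx hpx => ⟨?_, ?_⟩, fun x hx hpx => ⟨?_, ?_⟩⟩
  · obtain ⟨w, hw, rfl⟩ := hsqrt hx
    ext i j
    have h := qSn_swap hp0 hq hpq (hw i) (hw j)
    simp only [qSn] at h
    rw [Matrix.transpose_apply, Matrix.neg_apply, thetaMatrixEven, hpdef, Matrix.of_apply,
      Matrix.of_apply, mul_div_assoc, mul_div_assoc]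
    have := hw i
    have := hw j
    rw [div_mul_eq_div_div_swap, div_mul_eq_div_div_swap]
    generalize qTheta q (w i ^ 2 / w j ^ 2) / qTheta q (p * (w i ^ 2 / w j ^ 2)) = s at *
    generalize qTheta q (w j ^ 2 / w i ^ 2) / qTheta q (p * (w j ^ 2 / w i ^ 2)) = t at *
    field_simp at h ⊢
    exact h
  · have hpx' := hdiag hx hpx
    refine eq_of_generic hp0 hq hpq hx hpx'
      (F := fun x => pfaffEven m (thetaMatrixEven q x))
      (G := fun x => p ^ m.choose 2 * (∏ i, x i ^ ((m : ℤ) - ((i : ℕ) + 1 : ℤ))) *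
        ∏ i, ∏ j ∈ Finset.Ioi i, qTheta q (x j / x i) / qTheta q (p * x j / x i)) ?_ ?_ ?_
    · refine continuousAt_pf le_rfl fun i j => ?_
      simp only [thetaMatrixEven, hpdef, Matrix.of_apply]
      exact (continuousAt_qTheta_div hq hx i j).div
        ((continuous_apply j).continuousAt.mul (continuousAt_qTheta_mul_div hq hp0 hx i j))
        (mul_ne_zero (hx j) (hpx' i j))
    · exact (continuousAt_const.mul (continuousAt_prod_zpow hx _)).mul
        (continuousAt_prod_thetaRatio hp0 hq hx hpx')
    · intro w h1 h2
      have := pf_theta_even_of_generic hp0 hq hpq rfl w h1 h2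
      rw [← this, ← hpdef]
      rfl
  · obtain ⟨w, hw, rfl⟩ := hsqrt hx
    ext i j
    rw [Matrix.transpose_apply, Matrix.neg_apply, hodd, hodd]
    exact qZeta_swap hp0 hq hpq (hw i) (hw j)
  · have hpx' := hdiag hx hpx
    refine eq_of_generic hp0 hq hpq hx hpx'
      (F := fun x => pfaffOdd m (thetaMatrixOdd q x))
      (G := fun x => p ^ m.choose 2 * (qPoch q q ^ (2 * m) / qPoch q p ^ (2 * m)) *
        (∏ i, x i ^ ((m : ℤ) + 1 - ((i : ℕ) + 1 : ℤ))) *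
        ∏ i, ∏ j ∈ Finset.Ioi i, qTheta q (x j / x i) / qTheta q (p * x j / x i)) ?_ ?_ ?_
    · refine continuousAt_pf (Nat.le_succ _) fun i j => ?_
      simp only [thetaMatrixOdd, hpdef, Matrix.of_apply]
      exact ((continuous_apply i).continuousAt.mul
        (continuousAt_qThetaDeriv_mul_div hq hp0 hx j i)).div
        ((continuous_apply j).continuousAt.mul (continuousAt_qTheta_mul_div hq hp0 hx j i))
        (mul_ne_zero (hx j) (hpx' j i))
    · exact (continuousAt_const.mul (continuousAt_prod_zpow hx _)).mul
        (continuousAt_prod_thetaRatio hp0 hq hx hpx')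
    · intro w h1 h2
      have := pf_theta_odd_of_generic hp0 hp hq hpq rfl (Nat.le_succ _) w h1 h2
      have e : (fun i j => qZeta q p (w i) (w j)) = thetaMatrixOdd q fun i => (w i : ℂ) ^ 2 :=
        funext fun i => funext fun j => (hodd (fun i => (w i : ℂ)) i j).symm
      rw [← this, e]
      rfl
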